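/- A percolation model on a (possibly infinite) graph $G$ is a probability distribution on the subgraphs of $G$ (with the $\sigma$-algebra generated by the states of the vertices and edges); a vertex or edge of $G$ is open if it is present in the random subgraph and closed otherwise (its state). The model percolates if, with positive probability, the random subgraph has an infinite connected component. For $p_v\in(0,1]$ and $p_e\in[0,1]$ let $\mathcal D(G,p_v,p_e)$ be the family of percolation models on $G$ in which (i) each vertex is open with probability at least $p_v$; (ii) conditioned on both its endpoints being open, each edge is open with probability at least $p_e$; and (iii) for all vertex-disjoint subgraphs $G_1,G_2$ of $G$, the states of the vertices and edges in $G_1$ are independent of the states of the vertices and edges in $G_2$. Let $\mathbb Z^2\times\{0,1\}^{m}$ denote the graph in which two vertices are adjacent if they differ in exactly one coordinate, and differ by exactly $1$ in it. **Proposition.** Let $p_v\in(0,1]$ and $p_e\in(\tfrac{18}{19},1]$. Then there is an integer $N\ge 2$, depending only on $p_v$ and $p_e$, such that for every $n\ge N$ every model in $\mathcal D(\mathbb Z^2\times\{0,1\}^{n-2},p_v,p_e)$ percolates. -/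

import Mathlib

open MeasureTheory ProbabilityTheory

namespace Perc

section Model

variable {V : Type*} {G : SimpleGraph V}

/-- The event that the vertex `v` is open, i.e. present in the random subgraph of `G`. -/
def vertexOpen (G : SimpleGraph V) (v : V) : Set G.Subgraph := {H | v ∈ H.verts}

/-- The event that the edge `e` is open, i.e. present in the random subgraph of `G`. -/
def edgeOpen (G : SimpleGraph V) (e : Sym2 V) : Set G.Subgraph := {H | e ∈ H.edgeSet}

/-- The σ-algebra on the space of subgraphs of `G` generated by the states (open or closed) of
the vertices and edges of the fixed subgraph `K`. -/
@[reducible] def stateSigma (K : G.Subgraph) : MeasurableSpace G.Subgraph :=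
  MeasurableSpace.generateFrom
    ({A | ∃ v ∈ K.verts, A = vertexOpen G v} ∪ {A | ∃ e ∈ K.edgeSet, A = edgeOpen G e})

/-- The space of all subgraphs of `G` carries the σ-algebra generated by the states of all the
vertices and edges of `G`. -/
instance subgraphMeasurableSpace : MeasurableSpace G.Subgraph := stateSigma ⊤

/-- `MemClass G pv pe μ` says that `μ` belongs to the class `𝒟(G, pv, pe)`: `μ` is a percolation
model on `G`, i.e. a probability distribution on the subgraphs of `G`, such that
vertices are open with probability at least `pv`; conditioned on both their endpoints being open,
edges are open with probability at least `pe`; and the states of vertices and edges in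
vertex-disjoint subgraphs of `G` are independent. -/
structure MemClass (G : SimpleGraph V) (pv pe : ℝ) (μ : Measure G.Subgraph) : Prop where
  isProbabilityMeasure : IsProbabilityMeasure μ
  vertex_open : ∀ v : V, pv ≤ μ.real (vertexOpen G v)
  edge_open : ∀ u v : V, G.Adj u v →
    pe ≤ (cond μ (vertexOpen G u ∩ vertexOpen G v)).real (edgeOpen G s(u, v))
  indep : ∀ K L : G.Subgraph, Disjoint K.verts L.verts → Indep (stateSigma K) (stateSigma L) μ

/-- The subgraph `H` has an infinite connected component. -/
def HasInfiniteComponent (H : G.Subgraph) : Prop :=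
  ∃ c : H.coe.ConnectedComponent, c.supp.Infinite

/-- A percolation model percolates if the random subgraph has an infinite component with positive
probability. -/
def Percolates (μ : Measure G.Subgraph) : Prop :=
  0 < μ {H | HasInfiniteComponent H}

end Model

/-- The square lattice graph on `ℤ²`. -/
def squareLattice : SimpleGraph (ℤ × ℤ) where
  Adj x y := |x.1 - y.1| + |x.2 - y.2| = 1
  symm := ⟨fun x y h => by rw [abs_sub_comm y.1, abs_sub_comm y.2]; exact h⟩
  loopless := ⟨fun x h => by simp at h⟩

/-- The hypercube graph on `{0,1}^m`. -/
def hypercube (m : ℕ) : SimpleGraph (Fin m → Bool) where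
  Adj x y := hammingDist x y = 1
  symm := ⟨fun x y h => by rw [hammingDist_comm]; exact h⟩
  loopless := ⟨fun x h => by simp at h⟩

/-- The graph `ℤ² × {0,1}^m`, the Cartesian product of the square lattice and the hypercube:
two vertices are adjacent when they differ by `1` in exactly one coordinate. -/
def latticeCube (m : ℕ) : SimpleGraph ((ℤ × ℤ) × (Fin m → Bool)) :=
  SimpleGraph.boxProd squareLattice (hypercube m)

end Perc

/-! Over each site of `ℤ²` sits a hypercube. In it take `M` hubs `e_i`, `N` mids `e_{M+j}`, and the
spokes `e_i + e_{M+j}`, each adjacent to one hub and one mid. A hub over `x` and a hub over an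
adjacent site `y` are joined by `N` paths hub–spoke–mid–mid–spoke–hub that share only their ends.

Independence is available only for vertex-disjoint parts, so the edges at one hub may be arbitrarily
correlated. Call an open hub good if, in a weighted count, at most one fifth of its spokes are lost
to closed edges. Markov's inequality makes a hub good with probability at least `pv / 2`
(`measureReal_compl_goodHub_le`); distinct hubs over a site have disjoint stars, so many hubs almost
surely include a good one. The interiors of the `N` paths are disjoint, so a second moment argument
applies to them: in the mean at most 3/10 of the weight is lost to inner edges and at most 1/5 at
each good hub, which leaves a surplus of 3/10. Two good hubs are thus unjoined only with probability
`O(1/N)` (`measureReal_bridgesFail_le`). Weighting every open vertex by the inverse of its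
probability removes the unknown, unequal vertex probabilities from all these means.

Choosing `M`, then `N`, large makes every site good with probability at least 1 - 1/1250. The
goodness of a site depends only on nearby columns, so a multiscale argument with 5 × 5 blocks gives
an infinite connected family of good sites with positive probability
(`measure_forall_goodBlock_pos`, `exists_infinite_of_goodBlock`), and `HubSystem.percolates` lifts
it to an infinite component. -/

namespace Perc

/-! ### Local σ-algebras, normalised weights and second moments -/

section Region

variable {V : Type*} {G : SimpleGraph V}

/-- The σ-algebra generated by the states of all vertices of `S` and all edges inside `S`. -/
@[reducible] def regionSigma (G : SimpleGraph V) (S : Set V) : MeasurableSpace G.Subgraph :=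
  stateSigma ((⊤ : G.Subgraph).induce S)

theorem stateSigma_mono {K L : G.Subgraph} (h : K ≤ L) : stateSigma K ≤ stateSigma L := by
  refine MeasurableSpace.generateFrom_mono (Set.union_subset_union ?_ ?_)
  · rintro A ⟨v, hv, rfl⟩
    exact ⟨v, h.1 hv, rfl⟩
  · rintro A ⟨e, he, rfl⟩
    exact ⟨e, SimpleGraph.Subgraph.edgeSet_mono h he, rfl⟩

theorem regionSigma_mono : Monotone (regionSigma G) := fun _ _ h =>
  stateSigma_mono (SimpleGraph.Subgraph.induce_mono_right h)

theorem regionSigma_le (S : Set V) : regionSigma G S ≤ subgraphMeasurableSpace :=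
  stateSigma_mono le_top

theorem measurableSet_vertexOpen {S : Set V} {v : V} (hv : v ∈ S) :
    MeasurableSet[regionSigma G S] (vertexOpen G v) :=
  MeasurableSpace.measurableSet_generateFrom (Or.inl ⟨v, hv, rfl⟩)

theorem measurableSet_edgeOpen {S : Set V} {u v : V} (hu : u ∈ S) (hv : v ∈ S)
    (h : G.Adj u v) : MeasurableSet[regionSigma G S] (edgeOpen G s(u, v)) := by
  refine MeasurableSpace.measurableSet_generateFrom (Or.inr ⟨s(u, v), ?_, rfl⟩)
  rw [SimpleGraph.Subgraph.mem_edgeSet, SimpleGraph.Subgraph.induce_adj]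
  exact ⟨hu, hv, h⟩

/-- The event that `u` and `v` are open but the edge between them is closed. -/
def edgeFails (G : SimpleGraph V) (u v : V) : Set G.Subgraph :=
  vertexOpen G u ∩ vertexOpen G v ∩ (edgeOpen G s(u, v))ᶜ

theorem measurableSet_edgeFails {S : Set V} {u v : V} (hu : u ∈ S) (hv : v ∈ S)
    (h : G.Adj u v) : MeasurableSet[regionSigma G S] (edgeFails G u v) :=
  ((measurableSet_vertexOpen hu).inter (measurableSet_vertexOpen hv)).inter
    (measurableSet_edgeOpen hu hv h).compl

/-- The indicator of the event that `v` is open, normalised to have mean one. -/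
noncomputable def weight (μ : Measure G.Subgraph) (v : V) : G.Subgraph → ℝ :=
  (vertexOpen G v).indicator fun _ => (μ.real (vertexOpen G v))⁻¹

/-- The indicator of the event that the edge between `u` and `v` is closed although both its
endpoints are open. -/
noncomputable def failInd (G : SimpleGraph V) (u v : V) : G.Subgraph → ℝ :=
  (edgeFails G u v).indicator fun _ => 1

theorem measurable_weight {S : Set V} {v : V} (hv : v ∈ S) (μ : Measure G.Subgraph) :
    Measurable[regionSigma G S] (weight μ v) :=
  Measurable.indicator measurable_const (measurableSet_vertexOpen hv)

theorem measurable_failInd {S : Set V} {u v : V} (hu : u ∈ S) (hv : v ∈ S)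
    (h : G.Adj u v) : Measurable[regionSigma G S] (failInd G u v) :=
  Measurable.indicator measurable_const (measurableSet_edgeFails hu hv h)

theorem failInd_nonneg (u v : V) (H : G.Subgraph) : 0 ≤ failInd G u v H :=
  Set.indicator_nonneg (fun _ _ => zero_le_one) H

theorem failInd_le_one (u v : V) (H : G.Subgraph) : failInd G u v H ≤ 1 :=
  Set.indicator_le_self' (f := fun _ : G.Subgraph => (1 : ℝ)) (fun _ _ => zero_le_one) H

theorem weight_nonneg (μ : Measure G.Subgraph) (v : V) (H : G.Subgraph) : 0 ≤ weight μ v H :=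
  Set.indicator_nonneg (fun _ _ => inv_nonneg.2 measureReal_nonneg) H

theorem weight_of_mem (μ : Measure G.Subgraph) {v : V} {H : G.Subgraph} (h : v ∈ H.verts) :
    weight μ v H = (μ.real (vertexOpen G v))⁻¹ :=
  Set.indicator_of_mem (s := vertexOpen G v) h _

theorem weight_of_notMem (μ : Measure G.Subgraph) {v : V} {H : G.Subgraph} (h : v ∉ H.verts) :
    weight μ v H = 0 :=
  Set.indicator_of_notMem (s := vertexOpen G v) h _

theorem failInd_eq_one {u v : V} {H : G.Subgraph} (hu : u ∈ H.verts) (hv : v ∈ H.verts)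
    (h : ¬ H.Adj u v) : failInd G u v H = 1 :=
  Set.indicator_of_mem (s := edgeFails G u v) ⟨⟨hu, hv⟩, h⟩ _

namespace MemClass

variable {pv pe : ℝ} {μ : Measure G.Subgraph}

theorem weight_le (h : MemClass G pv pe μ) (hpv : 0 < pv) (v : V) (H : G.Subgraph) :
    weight μ v H ≤ pv⁻¹ := by
  by_cases hv : v ∈ H.verts
  · rw [weight_of_mem μ hv]
    exact inv_anti₀ hpv (h.vertex_open v)
  · rw [weight_of_notMem μ hv]
    positivity

theorem indep_region (h : MemClass G pv pe μ) {S T : Set V} (hST : Disjoint S T) :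
    Indep (regionSigma G S) (regionSigma G T) μ :=
  h.indep _ _ hST

theorem integral_mul (h : MemClass G pv pe μ) {S T : Set V} (hST : Disjoint S T)
    {f g : G.Subgraph → ℝ} (hf : Measurable[regionSigma G S] f)
    (hg : Measurable[regionSigma G T] g) : ∫ H, f H * g H ∂μ = (∫ H, f H ∂μ) * ∫ H, g H ∂μ := by
  have hind : IndepFun f g μ := by
    rw [IndepFun_iff_Indep]
    exact indep_of_indep_of_le_left (indep_of_indep_of_le_right (h.indep_region hST)
      hg.comap_le) hf.comap_le
  exact hind.integral_mul_eq_mul_integral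
    (hf.mono (regionSigma_le S) le_rfl).aestronglyMeasurable
    (hg.mono (regionSigma_le T) le_rfl).aestronglyMeasurable

theorem integral_weight (h : MemClass G pv pe μ) (hpv : 0 < pv) (v : V) :
    ∫ H, weight μ v H ∂μ = 1 := by
  unfold weight
  rw [integral_indicator_const _ (regionSigma_le {v} _ (measurableSet_vertexOpen rfl)),
    smul_eq_mul]
  exact mul_inv_cancel₀ (hpv.trans_le (h.vertex_open v)).ne'

/-- A weight has mean one and is independent of anything that avoids its vertex, so such factors can
be peeled off a product one at a time. -/
theorem integral_mul_weight (h : MemClass G pv pe μ) (hpv : 0 < pv) {S : Set V} {v : V}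
    (hv : v ∉ S) {f : G.Subgraph → ℝ} (hf : Measurable[regionSigma G S] f) :
    ∫ H, f H * weight μ v H ∂μ = ∫ H, f H ∂μ := by
  rw [h.integral_mul (T := {v}) (Set.disjoint_singleton_right.2 hv) hf 
      (measurable_weight (Set.mem_singleton v) μ),
    h.integral_weight hpv, mul_one]

/-- Distinct endpoints form vertex-disjoint subgraphs, hence are open independently, and the
conditioning event has a product probability. -/
theorem measureReal_edgeFails_le (h : MemClass G pv pe μ) (hpv : 0 < pv) {u v : V}
    (huv : G.Adj u v) : μ.real (edgeFails G u v) ≤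
      (1 - pe) * (μ.real (vertexOpen G u) * μ.real (vertexOpen G v)) := by
  have := h.isProbabilityMeasure
  have hmu : MeasurableSet (vertexOpen G u) :=
    regionSigma_le {u} _ (measurableSet_vertexOpen rfl)
  have hmv : MeasurableSet (vertexOpen G v) :=
    regionSigma_le {v} _ (measurableSet_vertexOpen rfl)
  have hme : MeasurableSet (edgeOpen G s(u, v)) :=
    regionSigma_le {u, v} _ (measurableSet_edgeOpen (by simp) (by simp) huv)
  set A := vertexOpen G u ∩ vertexOpen G v with hA
  have hAm : MeasurableSet A := hmu.inter hmv
  have hprod : μ.real A = μ.real (vertexOpen G u) * μ.real (vertexOpen G v) := by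
    have := (Indep_iff _ _ μ).1 (h.indep_region (S := {u}) (T := {v})
      (Set.disjoint_singleton.2 huv.ne)) _ _ (measurableSet_vertexOpen rfl)
      (measurableSet_vertexOpen rfl)
    rw [hA, measureReal_def, this, ENNReal.toReal_mul]
    rfl
  have hpos : 0 < μ.real A := by
    rw [hprod]
    exact mul_pos (hpv.trans_le (h.vertex_open u)) (hpv.trans_le (h.vertex_open v))
  have he := h.edge_open u v huv
  rw [measureReal_def, cond_apply hAm, ENNReal.toReal_mul, ENNReal.toReal_inv] at he
  change pe ≤ (μ.real A)⁻¹ * μ.real (A ∩ edgeOpen G s(u, v)) at he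
  rw [inv_mul_eq_div, le_div_iff₀ hpos] at he
  have hsplit := measureReal_inter_add_sdiff (μ := μ) (s := A) hme
  have : edgeFails G u v = A \ edgeOpen G s(u, v) := rfl
  rw [this, ← hprod]
  linarith

theorem integral_failInd_le (h : MemClass G pv pe μ) (hpv : 0 < pv) {u v : V}
    (huv : G.Adj u v) : ∫ H, failInd G u v H ∂μ ≤
      (1 - pe) * (μ.real (vertexOpen G u) * μ.real (vertexOpen G v)) := by
  unfold failInd
  rw [integral_indicator_const _
    (regionSigma_le {u, v} _ (measurableSet_edgeFails (by simp) (by simp) huv)), smul_eq_mul,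
    mul_one]
  exact h.measureReal_edgeFails_le hpv huv

theorem weight_mul_failInd (μ : Measure G.Subgraph) (u v : V) (H : G.Subgraph) :
    weight μ v H * failInd G u v H = (μ.real (vertexOpen G v))⁻¹ * failInd G u v H := by
  by_cases hH : H ∈ edgeFails G u v
  · rw [weight_of_mem μ hH.1.2]
  · simp [failInd, hH]

theorem weight_mul_weight_mul_failInd (μ : Measure G.Subgraph) (u v : V) (H : G.Subgraph) :
    weight μ u H * weight μ v H * failInd G u v H =
      (μ.real (vertexOpen G u))⁻¹ * (μ.real (vertexOpen G v))⁻¹ * failInd G u v H := by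
  by_cases hH : H ∈ edgeFails G u v
  · rw [weight_of_mem μ hH.1.2, weight_of_mem μ hH.1.1]
  · simp [failInd, hH]

/-- Only `v` is normalised: the remaining factor, the probability that `u` is open, is what lets
Markov's inequality be compared with that event. -/
theorem integral_weight_mul_failInd_le (h : MemClass G pv pe μ) (hpv : 0 < pv) {u v : V}
    (huv : G.Adj u v) :
    ∫ H, weight μ v H * failInd G u v H ∂μ ≤ (1 - pe) * μ.real (vertexOpen G u) := by
  have hv := hpv.trans_le (h.vertex_open v)
  simp_rw [weight_mul_failInd]
  rw [integral_const_mul, inv_mul_le_iff₀ hv]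
  exact (h.integral_failInd_le hpv huv).trans (le_of_eq (by ring))

theorem integral_weight_mul_weight_mul_failInd_le (h : MemClass G pv pe μ) (hpv : 0 < pv)
    {u v : V} (huv : G.Adj u v) :
    ∫ H, weight μ u H * weight μ v H * failInd G u v H ∂μ ≤ 1 - pe := by
  have hu := hpv.trans_le (h.vertex_open u)
  have hv := hpv.trans_le (h.vertex_open v)
  simp_rw [weight_mul_weight_mul_failInd]
  rw [integral_const_mul, mul_assoc, inv_mul_le_iff₀ hu, inv_mul_le_iff₀ hv]
  exact (h.integral_failInd_le hpv huv).trans (le_of_eq (by ring))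

theorem integrable_of_bounded (h : MemClass G pv pe μ) {S : Set V} {f : G.Subgraph → ℝ}
    (hf : Measurable[regionSigma G S] f) {A : ℝ} (hA : ∀ H, |f H| ≤ A) : Integrable f μ := by
  have := h.isProbabilityMeasure
  exact Integrable.of_bound (hf.mono (regionSigma_le S) le_rfl).aestronglyMeasurable A
    (Filter.Eventually.of_forall hA)

/-- Second moment bound for a sum of products in which the second factors are centred and
independent of each other and of all first factors. -/
theorem integral_sum_mul_sq_le (h : MemClass G pv pe μ) {κ : Type*} [Fintype κ] {S : Set V}
    {T : κ → Set V} (hST : ∀ j, Disjoint (T j) S) (hT : ∀ j l, j ≠ l → Disjoint (T j) (T l))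
    {f g : κ → G.Subgraph → ℝ} (hf : ∀ j, Measurable[regionSigma G S] (f j))
    (hg : ∀ j, Measurable[regionSigma G (T j)] (g j)) {A B : ℝ} (hA : ∀ j H, |f j H| ≤ A)
    (hB : ∀ j H, |g j H| ≤ B) (hc : ∀ j, ∫ H, g j H ∂μ = 0) :
    ∫ H, (∑ j, f j H * g j H) ^ 2 ∂μ ≤ Fintype.card κ * (A * B) ^ 2 := by
  classical
  have := h.isProbabilityMeasure
  have hbd : ∀ j H, |f j H * g j H| ≤ A * B := fun j H => by
    rw [abs_mul]
    exact mul_le_mul (hA j H) (hB j H) (abs_nonneg _) ((abs_nonneg _).trans (hA j H))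
  have hmS : ∀ j, Measurable[regionSigma G Set.univ] (f j) := fun j =>
    (hf j).mono (regionSigma_mono (Set.subset_univ _)) le_rfl
  have hmT : ∀ j, Measurable[regionSigma G Set.univ] (g j) := fun j =>
    (hg j).mono (regionSigma_mono (Set.subset_univ _)) le_rfl
  have hint : ∀ j l, Integrable (fun H => f j H * g j H * (f l H * g l H)) μ := fun j l =>
    h.integrable_of_bounded (((hmS j).mul (hmT j)).mul ((hmS l).mul (hmT l)))
      (A := A * B * (A * B)) fun H => by
        rw [abs_mul]
        exact mul_le_mul (hbd j H) (hbd l H) (abs_nonneg _) ((abs_nonneg _).trans (hbd j H))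
  have hterm : ∀ j l, ∫ H, f j H * g j H * (f l H * g l H) ∂μ ≤
      if j = l then (A * B) ^ 2 else 0 := by
    intro j l
    split_ifs with hjl
    · subst hjl
      have hle : ∀ H, f j H * g j H * (f j H * g j H) ≤ (A * B) ^ 2 := fun H => by
        rw [← sq]
        exact sq_le_sq' (by linarith [(abs_le.1 (hbd j H)).1]) (abs_le.1 (hbd j H)).2
      calc ∫ H, f j H * g j H * (f j H * g j H) ∂μ ≤ ∫ _, (A * B) ^ 2 ∂μ :=
            integral_mono (hint j j) (integrable_const _) hle
        _ = (A * B) ^ 2 := by simp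
    -- Off the diagonal, `g j` is centred and independent of the other three factors, however
    -- correlated `f j` and `f l` are.
    · have hm : Measurable[regionSigma G (S ∪ T l)] fun H => f j H * (f l H * g l H) :=
        ((hf j).mono (regionSigma_mono Set.subset_union_left) le_rfl).mul
          (((hf l).mono (regionSigma_mono Set.subset_union_left) le_rfl).mul
            ((hg l).mono (regionSigma_mono Set.subset_union_right) le_rfl))
      have hd : Disjoint (T j) (S ∪ T l) := Set.disjoint_union_right.2 ⟨hST j, hT j l hjl⟩
      have := h.integral_mul hd (hg j) hm
      rw [hc j, zero_mul] at this
      rw [← this]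
      exact le_of_eq (integral_congr_ae (Filter.Eventually.of_forall fun H => by ring))
  simp_rw [sq (∑ j, _), Finset.sum_mul_sum]
  rw [integral_finsetSum _ fun j _ => integrable_finsetSum _ fun l _ => hint j l]
  simp_rw [fun j => integral_finsetSum (μ := μ) Finset.univ fun l _ => hint j l]
  refine (Finset.sum_le_sum fun j _ => Finset.sum_le_sum fun l _ => hterm j l).trans ?_
  simp

end MemClass

end Region

end Perc

namespace Perc

/-! ### Good hubs and the paths between them -/

section Bridge

variable {V : Type*} {G : SimpleGraph V} {κ : Type*} [Fintype κ]

/-- The weighted number of open vertices `a j` whose edge to the open vertex `u` is closed. -/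
noncomputable def hubDefect (μ : Measure G.Subgraph) (u : V) (a : κ → V) (H : G.Subgraph) : ℝ :=
  ∑ j, weight μ (a j) H * failInd G u (a j) H

/-- The event that `u` is open and joined to most of its open neighbours among the `a j`. -/
def goodHub (μ : Measure G.Subgraph) (u : V) (a : κ → V) : Set G.Subgraph :=
  vertexOpen G u ∩ {H | hubDefect μ u a H ≤ Fintype.card κ / 5}

theorem measurable_hubDefect {S : Set V} {u : V} {a : κ → V} (hu : u ∈ S) (ha : ∀ j, a j ∈ S)
    (hadj : ∀ j, G.Adj u (a j)) (μ : Measure G.Subgraph) :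
    Measurable[regionSigma G S] (hubDefect μ u a) :=
  Finset.measurable_fun_sum _ fun j _ =>
    (measurable_weight (ha j) μ).mul (measurable_failInd hu (ha j) (hadj j))

theorem measurableSet_goodHub {S : Set V} {u : V} {a : κ → V} (hu : u ∈ S) (ha : ∀ j, a j ∈ S)
    (hadj : ∀ j, G.Adj u (a j)) (μ : Measure G.Subgraph) :
    MeasurableSet[regionSigma G S] (goodHub μ u a) :=
  (measurableSet_vertexOpen hu).inter
    (measurable_hubDefect hu ha hadj μ measurableSet_Iic)

/-- The event that none of the paths `u, p 0 j, p 1 j, p 2 j, p 3 j, w` is open. -/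
def bridgesFail (G : SimpleGraph V) (u w : V) (p : Fin 4 → κ → V) : Set G.Subgraph :=
  {H | ∀ j, ¬ (H.Adj u (p 0 j) ∧ H.Adj (p 0 j) (p 1 j) ∧ H.Adj (p 1 j) (p 2 j) ∧
    H.Adj (p 2 j) (p 3 j) ∧ H.Adj (p 3 j) w)}

theorem abs_mul_le_mul {x y A B : ℝ} (hx : |x| ≤ A) (hy : |y| ≤ B) : |x * y| ≤ A * B := by
  rw [abs_mul]
  exact mul_le_mul hx hy (abs_nonneg _) ((abs_nonneg _).trans hx)

namespace MemClass

variable {pv pe : ℝ} {μ : Measure G.Subgraph}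

theorem abs_weight_le (h : MemClass G pv pe μ) (hpv : 0 < pv) (v : V) (H : G.Subgraph) :
    |weight μ v H| ≤ pv⁻¹ := by
  rw [abs_of_nonneg (weight_nonneg μ v H)]
  exact h.weight_le hpv v H

theorem abs_failInd_le (u v : V) (H : G.Subgraph) : |failInd G u v H| ≤ 1 := by
  rw [abs_of_nonneg (failInd_nonneg u v H)]
  exact failInd_le_one u v H

/-- Markov's inequality at the threshold `card κ / 5`: since `5 * (1 - pe) ≤ 1 / 2`, a large defect
uses up at most half of the probability that `u` is open. No independence between the edges at `u`
is needed. -/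
theorem measureReal_compl_goodHub_le (h : MemClass G pv pe μ) (hpv : 0 < pv) (hpe : 9 / 10 ≤ pe)
    [Nonempty κ] {u : V} {a : κ → V} (hadj : ∀ j, G.Adj u (a j)) :
    μ.real (goodHub μ u a)ᶜ ≤ 1 - pv / 2 := by
  have := h.isProbabilityMeasure
  have hN : (0 : ℝ) < Fintype.card κ := by exact_mod_cast Fintype.card_pos
  have hint : ∀ j, Integrable (fun H => weight μ (a j) H * failInd G u (a j) H) μ := fun j =>
    h.integrable_of_bounded (S := Set.univ) ((measurable_weight (Set.mem_univ _) μ).mul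
      (measurable_failInd (Set.mem_univ _) (Set.mem_univ _) (hadj j))) fun H =>
        abs_mul_le_mul (h.abs_weight_le hpv _ H) (abs_failInd_le _ _ H)
  have hmean : ∫ H, hubDefect μ u a H ∂μ ≤
      Fintype.card κ * ((1 - pe) * μ.real (vertexOpen G u)) := by
    unfold hubDefect
    rw [integral_finsetSum _ fun j _ => hint j]
    refine (Finset.sum_le_card_nsmul _ _ _ fun j _ =>
      h.integral_weight_mul_failInd_le hpv (hadj j)).trans (le_of_eq ?_)
    rw [nsmul_eq_mul, Finset.card_univ]
  have hmark := mul_meas_ge_le_integral_of_nonneg (μ := μ) (f := hubDefect μ u a)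
    (Filter.Eventually.of_forall fun H => Finset.sum_nonneg fun j _ =>
      mul_nonneg (weight_nonneg _ _ _) (failInd_nonneg _ _ _))
    (integrable_finsetSum _ fun j _ => hint j) (Fintype.card κ / 5)
  set B := {H | (Fintype.card κ / 5 : ℝ) ≤ hubDefect μ u a H}
  have hu := h.vertex_open u
  have hB : μ.real B ≤ μ.real (vertexOpen G u) / 2 := by
    have h1 : (Fintype.card κ : ℝ) * (μ.real B / 5) ≤
        Fintype.card κ * ((1 - pe) * μ.real (vertexOpen G u)) := by
      linarith [hmark.trans hmean]
    have h2 := le_of_mul_le_mul_left h1 hN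
    nlinarith
  have hmu : MeasurableSet (vertexOpen G u) :=
    regionSigma_le {u} _ (measurableSet_vertexOpen rfl)
  have hsub : (goodHub μ u a)ᶜ ⊆ (vertexOpen G u)ᶜ ∪ B := by
    intro H hH
    by_cases hHu : H ∈ vertexOpen G u
    · have hlt : (Fintype.card κ / 5 : ℝ) < hubDefect μ u a H :=
        not_le.1 fun hle => hH ⟨hHu, hle⟩
      exact Or.inr hlt.le
    · exact Or.inl hHu
  have := (measureReal_mono (μ := μ) hsub (measure_ne_top μ _)).trans (measureReal_union_le _ _)
  rw [probReal_compl_eq_one_sub hmu] at this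
  linarith

theorem integral_weight_mul_four (h : MemClass G pv pe μ) (hpv : 0 < pv) {a b c d : V}
    (hab : a ≠ b) (hac : a ≠ c) (had : a ≠ d) (hbc : b ≠ c) (hbd : b ≠ d) (hcd : c ≠ d) :
    ∫ H, weight μ a H * weight μ b H * weight μ c H * weight μ d H ∂μ = 1 := by
  have ma : Measurable[regionSigma G {a, b, c}] (weight μ a) := measurable_weight (by simp) μ
  have mb : Measurable[regionSigma G {a, b, c}] (weight μ b) := measurable_weight (by simp) μ
  have mc : Measurable[regionSigma G {a, b, c}] (weight μ c) := measurable_weight (by simp) μ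
  have ma' : Measurable[regionSigma G {a, b}] (weight μ a) := measurable_weight (by simp) μ
  have mb' : Measurable[regionSigma G {a, b}] (weight μ b) := measurable_weight (by simp) μ
  rw [h.integral_mul_weight hpv (S := {a, b, c}) (by simp [had.symm, hbd.symm, hcd.symm])
    ((ma.fun_mul mb).fun_mul mc), h.integral_mul_weight hpv (S := {a, b})
    (by simp [hac.symm, hbc.symm]) (ma'.fun_mul mb'), h.integral_mul_weight hpv (S := {a})
    (by simp [hab.symm]) (measurable_weight (Set.mem_singleton a) μ), h.integral_weight hpv]

theorem integral_weight_mul_three (h : MemClass G pv pe μ) (hpv : 0 < pv) {a b c : V}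
    (hab : a ≠ b) (hac : a ≠ c) (hbc : b ≠ c) :
    ∫ H, weight μ a H * weight μ b H * weight μ c H ∂μ = 1 := by
  have ma' : Measurable[regionSigma G {a, b}] (weight μ a) := measurable_weight (by simp) μ
  have mb' : Measurable[regionSigma G {a, b}] (weight μ b) := measurable_weight (by simp) μ
  rw [h.integral_mul_weight hpv (S := {a, b})
    (by simp [hac.symm, hbc.symm]) (ma'.fun_mul mb'), h.integral_mul_weight hpv (S := {a})
    (by simp [hab.symm]) (measurable_weight (Set.mem_singleton a) μ), h.integral_weight hpv]

theorem integral_weight_mul_four_mul_failInd_le (h : MemClass G pv pe μ) (hpv : 0 < pv)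
    {a b c d : V} (hab : G.Adj a b) (hac : a ≠ c) (had : a ≠ d) (hbc : b ≠ c) (hbd : b ≠ d)
    (hcd : c ≠ d) :
    ∫ H, weight μ a H * weight μ b H * failInd G a b H * weight μ c H * weight μ d H ∂μ ≤
      1 - pe := by
  have ma : Measurable[regionSigma G {a, b, c}] (weight μ a) := measurable_weight (by simp) μ
  have mb : Measurable[regionSigma G {a, b, c}] (weight μ b) := measurable_weight (by simp) μ
  have mc : Measurable[regionSigma G {a, b, c}] (weight μ c) := measurable_weight (by simp) μ
  have mf : Measurable[regionSigma G {a, b, c}] (failInd G a b) :=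
    measurable_failInd (by simp) (by simp) hab
  have ma' : Measurable[regionSigma G {a, b}] (weight μ a) := measurable_weight (by simp) μ
  have mb' : Measurable[regionSigma G {a, b}] (weight μ b) := measurable_weight (by simp) μ
  have mf' : Measurable[regionSigma G {a, b}] (failInd G a b) :=
    measurable_failInd (by simp) (by simp) hab
  rw [h.integral_mul_weight hpv (S := {a, b, c}) (by simp [had.symm, hbd.symm, hcd.symm])
    (((ma.fun_mul mb).fun_mul mf).fun_mul mc), h.integral_mul_weight hpv (S := {a, b})
    (by simp [hac.symm, hbc.symm]) ((ma'.fun_mul mb').fun_mul mf')]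
  exact h.integral_weight_mul_weight_mul_failInd_le hpv hab

/-- The weight of a path of four vertices, diminished by its closed edges. -/
noncomputable def pathWeight (μ : Measure G.Subgraph) (a b c d : V) (H : G.Subgraph) : ℝ :=
  weight μ a H * weight μ b H * weight μ c H * weight μ d H *
    (1 - failInd G a b H - failInd G b c H - failInd G c d H)

theorem measurable_pathWeight {S : Set V} {a b c d : V} (ha : a ∈ S) (hb : b ∈ S) (hc : c ∈ S)
    (hd : d ∈ S) (hab : G.Adj a b) (hbc : G.Adj b c) (hcd : G.Adj c d) (μ : Measure G.Subgraph) :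
    Measurable[regionSigma G S] (pathWeight μ a b c d) :=
  ((((measurable_weight ha μ).mul (measurable_weight hb μ)).mul (measurable_weight hc μ)).mul
    (measurable_weight hd μ)).mul (((measurable_const.sub (measurable_failInd ha hb hab)).sub
      (measurable_failInd hb hc hbc)).sub (measurable_failInd hc hd hcd))

theorem abs_pathWeight_le (h : MemClass G pv pe μ) (hpv : 0 < pv) (a b c d : V)
    (H : G.Subgraph) : |pathWeight μ a b c d H| ≤ 2 * pv⁻¹ ^ 4 := by
  refine (abs_mul_le_mul (abs_mul_le_mul (abs_mul_le_mul (abs_mul_le_mul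
    (h.abs_weight_le hpv a H) (h.abs_weight_le hpv b H)) (h.abs_weight_le hpv c H))
    (h.abs_weight_le hpv d H)) (B := 2) (abs_le.2 ?_)).trans (le_of_eq (by ring))
  have h1 := failInd_nonneg a b H
  have h2 := failInd_nonneg b c H
  have h3 := failInd_nonneg c d H
  have h1' := failInd_le_one a b H
  have h2' := failInd_le_one b c H
  have h3' := failInd_le_one c d H
  constructor <;> linarith

/-- A union bound in the mean: the product of weights has mean one, and each of the three
closed-edge terms costs at most `1 - pe`, because the weights off the edge factor out. -/
theorem le_integral_pathWeight (h : MemClass G pv pe μ) (hpv : 0 < pv) {a b c d : V}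
    (hab : G.Adj a b) (hbc : G.Adj b c) (hcd : G.Adj c d) (hac : a ≠ c) (had : a ≠ d)
    (hbd : b ≠ d) : 1 - 3 * (1 - pe) ≤ ∫ H, pathWeight μ a b c d H ∂μ := by
  have key := h.integral_weight_mul_four hpv hab.ne hac had hbc.ne hbd hcd.ne
  have k1 := h.integral_weight_mul_four_mul_failInd_le hpv hab hac had hbc.ne hbd hcd.ne
  have k2 := h.integral_weight_mul_four_mul_failInd_le hpv hbc hab.ne' hbd hac.symm hcd.ne had
  have k3 := h.integral_weight_mul_four_mul_failInd_le hpv hcd hac.symm hbc.ne' had.symm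
    hbd.symm hab.ne
  have m : ∀ v, Measurable[regionSigma G Set.univ] (weight μ v) := fun v =>
    measurable_weight (Set.mem_univ _) μ
  have w := fun v H => h.abs_weight_le hpv v H
  have i0 : Integrable (fun H => weight μ a H * weight μ b H * weight μ c H * weight μ d H) μ :=
    h.integrable_of_bounded ((((m a).mul (m b)).mul (m c)).mul (m d)) fun H =>
      abs_mul_le_mul (abs_mul_le_mul (abs_mul_le_mul (w a H) (w b H)) (w c H)) (w d H)
  have i1 : ∀ {a b} (c d), G.Adj a b → Integrable (fun H => weight μ a H * weight μ b H *
      failInd G a b H * weight μ c H * weight μ d H) μ := fun {a b} c d hab =>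
    h.integrable_of_bounded (((((m a).mul (m b)).mul
      (measurable_failInd (Set.mem_univ _) (Set.mem_univ _) hab)).mul (m c)).mul (m d)) fun H =>
      abs_mul_le_mul (abs_mul_le_mul (abs_mul_le_mul (abs_mul_le_mul (w a H) (w b H))
        (abs_failInd_le _ _ H)) (w c H)) (w d H)
  have e : ∀ H, pathWeight μ a b c d H =
      weight μ a H * weight μ b H * weight μ c H * weight μ d H -
      weight μ a H * weight μ b H * failInd G a b H * weight μ c H * weight μ d H -
      weight μ b H * weight μ c H * failInd G b c H * weight μ a H * weight μ d H -
      weight μ c H * weight μ d H * failInd G c d H * weight μ a H * weight μ b H := fun H => by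
    unfold pathWeight; ring
  have i2 : Integrable (fun H => weight μ a H * weight μ b H * weight μ c H * weight μ d H -
      weight μ a H * weight μ b H * failInd G a b H * weight μ c H * weight μ d H) μ :=
    i0.sub (i1 c d hab)
  have i3 : Integrable (fun H => weight μ a H * weight μ b H * weight μ c H * weight μ d H -
      weight μ a H * weight μ b H * failInd G a b H * weight μ c H * weight μ d H -
      weight μ b H * weight μ c H * failInd G b c H * weight μ a H * weight μ d H) μ :=
    i2.sub (i1 a d hbc)
  simp_rw [e]
  rw [integral_sub i3 (i1 a b hcd), integral_sub i2 (i1 a d hbc), integral_sub i0 (i1 c d hab)]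
  linarith

/-- If an inner vertex is closed, both sides vanish. Otherwise one of the five edges is closed, so
the five failure indicators sum to at least one; multiply by the weights and move the inner three
across. -/
theorem pathWeight_le (μ : Measure G.Subgraph) {u w a b c d : V} {H : G.Subgraph}
    (hu : u ∈ H.verts) (hw : w ∈ H.verts)
    (hp : ¬ (H.Adj u a ∧ H.Adj a b ∧ H.Adj b c ∧ H.Adj c d ∧ H.Adj d w)) :
    pathWeight μ a b c d H ≤ weight μ a H * failInd G u a H *
      (weight μ b H * weight μ c H * weight μ d H) + weight μ d H * failInd G w d H *
      (weight μ a H * weight μ b H * weight μ c H) := by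
  unfold pathWeight
  by_cases ha : a ∈ H.verts
  swap
  · simp [weight_of_notMem μ ha]
  by_cases hb : b ∈ H.verts
  swap
  · simp [weight_of_notMem μ hb]
  by_cases hc : c ∈ H.verts
  swap
  · simp [weight_of_notMem μ hc]
  by_cases hd : d ∈ H.verts
  swap
  · simp [weight_of_notMem μ hd]
  have n0 := failInd_nonneg (G := G) u a H
  have n1 := failInd_nonneg (G := G) a b H
  have n2 := failInd_nonneg (G := G) b c H
  have n3 := failInd_nonneg (G := G) c d H
  have n4 := failInd_nonneg (G := G) w d H
  have hsum : 1 ≤ failInd G u a H + failInd G a b H + failInd G b c H + failInd G c d H +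
      failInd G w d H := by
    by_contra! hlt
    have c0 : H.Adj u a := by
      by_contra hn
      linarith [failInd_eq_one hu ha hn]
    have c1 : H.Adj a b := by
      by_contra hn
      linarith [failInd_eq_one ha hb hn]
    have c2 : H.Adj b c := by
      by_contra hn
      linarith [failInd_eq_one hb hc hn]
    have c3 : H.Adj c d := by
      by_contra hn
      linarith [failInd_eq_one hc hd hn]
    have c4 : H.Adj w d := by
      by_contra hn
      linarith [failInd_eq_one hw hd hn]
    exact hp ⟨c0, c1, c2, c3, c4.symm⟩
  have hX : 0 ≤ weight μ a H * weight μ b H * weight μ c H * weight μ d H :=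
    mul_nonneg (mul_nonneg (mul_nonneg (weight_nonneg μ a H) (weight_nonneg μ b H))
      (weight_nonneg μ c H)) (weight_nonneg μ d H)
  nlinarith [mul_nonneg hX (sub_nonneg.2 hsum)]

/-- Two good hubs are very likely to be joined if there are many paths between them. -/
theorem measureReal_bridgesFail_le (h : MemClass G pv pe μ) (hpv : 0 < pv) (hpv1 : pv ≤ 1)
    (hpe : 9 / 10 ≤ pe) [Nonempty κ] {u w : V} {p : Fin 4 → κ → V}
    (hp : ∀ s j s' j', p s j = p s' j' → s = s' ∧ j = j')
    (hu : ∀ s j, u ≠ p s j) (hw : ∀ s j, w ≠ p s j) (hadju : ∀ j, G.Adj u (p 0 j))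
    (h01 : ∀ j, G.Adj (p 0 j) (p 1 j)) (h12 : ∀ j, G.Adj (p 1 j) (p 2 j))
    (h23 : ∀ j, G.Adj (p 2 j) (p 3 j)) (hadjw : ∀ j, G.Adj w (p 3 j)) :
    μ.real (goodHub μ u (p 0) ∩ goodHub μ w (p 3) ∩ bridgesFail G u w p) ≤
      1600 * pv⁻¹ ^ 8 / Fintype.card κ := by
  have := h.isProbabilityMeasure
  have hN : (0 : ℝ) < Fintype.card κ := by exact_mod_cast Fintype.card_pos
  set N : ℝ := ((Fintype.card κ : ℕ) : ℝ)
  set K := pv⁻¹ with hK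
  have hK1 : 1 ≤ K := (one_le_inv₀ hpv).2 hpv1
  have hne : ∀ s j s' j', s ≠ s' → p s j ≠ p s' j' := fun s j s' j' hs he => hs (hp s j s' j' he).1
  set T : κ → Set V := fun j => Set.range fun s => p s j with hT
  have hmem : ∀ s j, p s j ∈ T j := fun s j => ⟨s, rfl⟩
  have hTd : ∀ j l, j ≠ l → Disjoint (T j) (T l) := by
    intro j l hjl
    rw [Set.disjoint_left]
    rintro _ ⟨s, rfl⟩ ⟨s', hs'⟩
    exact hjl (hp _ _ _ _ hs').2.symm
  set m : κ → ℝ := fun j => ∫ H, pathWeight μ (p 0 j) (p 1 j) (p 2 j) (p 3 j) H ∂μ with hm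
  have wle := fun v H => h.abs_weight_le hpv v H
  have hK4 : 1 ≤ K ^ 4 := one_le_pow₀ hK1
  have hK3 : 1 ≤ K ^ 3 := one_le_pow₀ hK1
  have hmle : ∀ j, |m j| ≤ 2 * K ^ 4 := fun j => by
    have := norm_integral_le_of_norm_le_const (μ := μ)
      (f := pathWeight μ (p 0 j) (p 1 j) (p 2 j) (p 3 j)) (Filter.Eventually.of_forall
      (h.abs_pathWeight_le hpv (p 0 j) (p 1 j) (p 2 j) (p 3 j)))
    rwa [probReal_univ, mul_one] at this
  -- the three centred sums
  have S1 : ∫ H, (∑ j, 1 * (pathWeight μ (p 0 j) (p 1 j) (p 2 j) (p 3 j) H - m j)) ^ 2 ∂μ ≤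
      N * (1 * (4 * K ^ 4)) ^ 2 := by
    refine h.integral_sum_mul_sq_le (S := ∅) (T := T) (fun j => Set.disjoint_empty _) hTd
      (f := fun _ _ => 1) (fun j => measurable_const)
      (g := fun j H => pathWeight μ (p 0 j) (p 1 j) (p 2 j) (p 3 j) H - m j)
      (fun j => (measurable_pathWeight (hmem 0 j) (hmem 1 j) (hmem 2 j) (hmem 3 j) (h01 j)
        (h12 j) (h23 j) μ).sub measurable_const) (fun j H => by simp) (fun j H => ?_) fun j => ?_
    · refine (abs_sub _ _).trans ?_
      linarith [h.abs_pathWeight_le hpv (p 0 j) (p 1 j) (p 2 j) (p 3 j) H, hmle j]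
    · rw [integral_sub (h.integrable_of_bounded (measurable_pathWeight (hmem 0 j) (hmem 1 j)
        (hmem 2 j) (hmem 3 j) (h01 j) (h12 j) (h23 j) μ)
        (h.abs_pathWeight_le hpv _ _ _ _)) (integrable_const _)]
      simp [hm]
  have w3 : ∀ a b c H, |weight μ a H * weight μ b H * weight μ c H| ≤ K ^ 3 := fun a b c H =>
    (abs_mul_le_mul (abs_mul_le_mul (wle a H) (wle b H)) (wle c H)).trans (le_of_eq (by ring))
  -- The failures at the hub `v` are correlated, but they live on `v` and its spokes; the other
  -- three vertices of the paths are disjoint from these and from each other. Thus replacing their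
  -- weights by the mean one costs only a fluctuation of variance `O(N)`.
  have star : ∀ (v : V) (s a b c : Fin 4), (∀ s j, v ≠ p s j) → (∀ j, G.Adj v (p s j)) →
      s ≠ a → s ≠ b → s ≠ c → a ≠ b → a ≠ c → b ≠ c →
      ∫ H, (∑ j, weight μ (p s j) H * failInd G v (p s j) H *
        (weight μ (p a j) H * weight μ (p b j) H * weight μ (p c j) H - 1)) ^ 2 ∂μ ≤
      N * (K * (2 * K ^ 3)) ^ 2 := by
    intro v s a b c hv hadj hsa hsb hsc hab hac hbc
    set T' : κ → Set V := fun j => {p a j, p b j, p c j} with hT'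
    have hT'T : ∀ j, T' j ⊆ T j := by
      rintro j x (rfl | rfl | rfl)
      exacts [hmem a j, hmem b j, hmem c j]
    have mm : ∀ j, Measurable[regionSigma G (T' j)]
        fun H => weight μ (p a j) H * weight μ (p b j) H * weight μ (p c j) H := fun j =>
      ((measurable_weight (by simp [hT']) μ).mul (measurable_weight (by simp [hT']) μ)).mul
        (measurable_weight (by simp [hT']) μ)
    refine h.integral_sum_mul_sq_le (S := insert v (Set.range (p s))) (T := T') (fun j => ?_)
      (fun j l hjl => (hTd j l hjl).mono (hT'T j) (hT'T l))
      (f := fun j H => weight μ (p s j) H * failInd G v (p s j) H)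
      (g := fun j H => weight μ (p a j) H * weight μ (p b j) H * weight μ (p c j) H - 1)
      (fun j => (measurable_weight (by simp) μ).mul
        (measurable_failInd (by simp) (by simp) (hadj j)))
      (fun j => (mm j).sub measurable_const) (fun j H => ?_) (fun j H => ?_) fun j => ?_
    · rw [Set.disjoint_left]
      have : ∀ t, s ≠ t → p t j ∉ insert v (Set.range (p s)) := by
        rintro t hst (h1 | ⟨l, hl⟩)
        · exact hv t j h1.symm
        · exact hne s l t j hst hl
      rintro x (rfl | rfl | rfl)
      exacts [this a hsa, this b hsb, this c hsc]
    · exact (abs_mul_le_mul (wle _ H) (abs_failInd_le _ _ H)).trans (le_of_eq (mul_one _))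
    · refine (abs_sub _ _).trans ?_
      rw [abs_one]
      linarith [w3 (p a j) (p b j) (p c j) H]
    · rw [integral_sub (h.integrable_of_bounded (mm j) (w3 _ _ _)) (integrable_const _),
        h.integral_weight_mul_three hpv (hne _ _ _ _ hab) (hne _ _ _ _ hac) (hne _ _ _ _ hbc)]
      simp
  have S2 := star u 0 1 2 3 hu hadju (by decide) (by decide) (by decide) (by decide) (by decide)
    (by decide)
  have S3 := star w 3 0 1 2 hw hadjw (by decide) (by decide) (by decide) (by decide) (by decide)
    (by decide)
  set X1 : G.Subgraph → ℝ := fun H =>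
    ∑ j, 1 * (pathWeight μ (p 0 j) (p 1 j) (p 2 j) (p 3 j) H - m j) with hX1
  set X2 : G.Subgraph → ℝ := fun H => ∑ j, weight μ (p 0 j) H * failInd G u (p 0 j) H *
    (weight μ (p 1 j) H * weight μ (p 2 j) H * weight μ (p 3 j) H - 1) with hX2
  set X3 : G.Subgraph → ℝ := fun H => ∑ j, weight μ (p 3 j) H * failInd G w (p 3 j) H *
    (weight μ (p 0 j) H * weight μ (p 1 j) H * weight μ (p 2 j) H - 1) with hX3
  have mw : ∀ v, Measurable[regionSigma G Set.univ] (weight μ v) := fun v =>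
    measurable_weight (Set.mem_univ _) μ
  have mX1 : Measurable[regionSigma G Set.univ] X1 := Finset.measurable_fun_sum _ fun j _ =>
    measurable_const.mul ((measurable_pathWeight (Set.mem_univ _) (Set.mem_univ _) (Set.mem_univ _) (Set.mem_univ _) (h01 j) (h12 j)
      (h23 j) μ).sub measurable_const)
  have mX2 : Measurable[regionSigma G Set.univ] X2 := Finset.measurable_fun_sum _ fun j _ =>
    ((mw _).mul (measurable_failInd (Set.mem_univ _) (Set.mem_univ _) (hadju j))).mul
      ((((mw _).mul (mw _)).mul (mw _)).sub measurable_const)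
  have mX3 : Measurable[regionSigma G Set.univ] X3 := Finset.measurable_fun_sum _ fun j _ =>
    ((mw _).mul (measurable_failInd (Set.mem_univ _) (Set.mem_univ _) (hadjw j))).mul
      ((((mw _).mul (mw _)).mul (mw _)).sub measurable_const)
  have sqInt : ∀ X : G.Subgraph → ℝ, Measurable[regionSigma G Set.univ] X → ∀ A,
      (∀ H, |X H| ≤ A) → Integrable (fun H => X H ^ 2) μ := fun X hX A hA =>
    h.integrable_of_bounded (hX.pow_const 2) (A := A ^ 2) fun H => by
      rw [abs_pow]
      exact pow_le_pow_left₀ (abs_nonneg _) (hA H) 2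
  have bX1 : ∀ H, |X1 H| ≤ ∑ _ : κ, (4 * K ^ 4) := fun H =>
    (Finset.abs_sum_le_sum_abs _ _).trans (Finset.sum_le_sum fun j _ => by
      rw [one_mul]
      refine (abs_sub _ _).trans ?_
      linarith [h.abs_pathWeight_le hpv (p 0 j) (p 1 j) (p 2 j) (p 3 j) H, hmle j])
  have bst : ∀ v s a b c H, |weight μ s H * failInd G v s H *
      (weight μ a H * weight μ b H * weight μ c H - 1)| ≤ K * 1 * (2 * K ^ 3) :=
    fun v s a b c H => abs_mul_le_mul (abs_mul_le_mul (wle _ H) (abs_failInd_le _ _ H)) (by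
      refine (abs_sub _ _).trans ?_
      rw [abs_one]
      linarith [w3 a b c H])
  have bX2 : ∀ H, |X2 H| ≤ ∑ _ : κ, (K * 1 * (2 * K ^ 3)) := fun H =>
    (Finset.abs_sum_le_sum_abs _ _).trans (Finset.sum_le_sum fun j _ => bst _ _ _ _ _ H)
  have bX3 : ∀ H, |X3 H| ≤ ∑ _ : κ, (K * 1 * (2 * K ^ 3)) := fun H =>
    (Finset.abs_sum_le_sum_abs _ _).trans (Finset.sum_le_sum fun j _ => bst _ _ _ _ _ H)
  have I1 := sqInt X1 mX1 _ bX1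
  have I2 := sqInt X2 mX2 _ bX2
  have I3 := sqInt X3 mX3 _ bX3
  have Itot : Integrable (fun H => 3 * (X1 H ^ 2 + X2 H ^ 2 + X3 H ^ 2)) μ :=
    ((I1.add I2).add I3).const_mul 3
  have hmean : ∫ H, 3 * (X1 H ^ 2 + X2 H ^ 2 + X3 H ^ 2) ∂μ ≤ 144 * K ^ 8 * N := by
    rw [integral_const_mul, integral_add (I1.fun_add I2) I3, integral_add I1 I2]
    nlinarith
  have hmark := mul_meas_ge_le_integral_of_nonneg (μ := μ)
    (Filter.Eventually.of_forall fun H => by positivity) Itot ((3 / 10 * N) ^ 2)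
  set B := {H | (3 / 10 * N) ^ 2 ≤ 3 * (X1 H ^ 2 + X2 H ^ 2 + X3 H ^ 2)}
  -- If all paths fail, the path weights, of total mean at least `7 / 10 * N`, are dominated by the
  -- two hub defects, at most `2 / 5 * N`, up to fluctuations. So `X2 + X3 - X1` must cover the gap
  -- `3 / 10 * N`.
  have hsub : goodHub μ u (p 0) ∩ goodHub μ w (p 3) ∩ bridgesFail G u w p ⊆ B := by
    rintro H ⟨⟨⟨hHu, hdu⟩, hHw, hdw⟩, hfail⟩
    change (3 / 10 * N) ^ 2 ≤ 3 * (X1 H ^ 2 + X2 H ^ 2 + X3 H ^ 2)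
    have e1 : X1 H = ∑ j, pathWeight μ (p 0 j) (p 1 j) (p 2 j) (p 3 j) H - ∑ j, m j := by
      simp [hX1]
    have e2 : X2 H = ∑ j, weight μ (p 0 j) H * failInd G u (p 0 j) H *
        (weight μ (p 1 j) H * weight μ (p 2 j) H * weight μ (p 3 j) H) -
          hubDefect μ u (p 0) H := by
      simp [hX2, hubDefect, mul_sub]
    have e3 : X3 H = ∑ j, weight μ (p 3 j) H * failInd G w (p 3 j) H *
        (weight μ (p 0 j) H * weight μ (p 1 j) H * weight μ (p 2 j) H) -
          hubDefect μ w (p 3) H := by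
      simp [hX3, hubDefect, mul_sub]
    have hle := Finset.sum_le_sum fun j (_ : j ∈ Finset.univ) => pathWeight_le μ hHu hHw (hfail j)
    rw [Finset.sum_add_distrib] at hle
    have hms : N * (7 / 10) ≤ ∑ j, m j := by
      have := Finset.card_nsmul_le_sum Finset.univ m (7 / 10) fun j _ => by
        have := h.le_integral_pathWeight hpv (h01 j) (h12 j) (h23 j)
          (hne 0 j 2 j (by decide)) (hne 0 j 3 j (by decide)) (hne 1 j 3 j (by decide))
        exact le_trans (by linarith) this
      rwa [nsmul_eq_mul, Finset.card_univ] at this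
    have hdu' : hubDefect μ u (p 0) H ≤ N / 5 := hdu
    have hdw' : hubDefect μ w (p 3) H ≤ N / 5 := hdw
    have hZ : 3 / 10 * N ≤ X2 H + X3 H - X1 H := by linarith
    have hZ2 : (3 / 10 * N) ^ 2 ≤ (X2 H + X3 H - X1 H) ^ 2 :=
      pow_le_pow_left₀ (by positivity) hZ 2
    -- The Cauchy–Schwarz inequality for three terms, the source of the factor 3 in `B`.
    nlinarith [sq_nonneg (X2 H - X3 H), sq_nonneg (X2 H + X1 H), sq_nonneg (X3 H + X1 H)]
  refine (measureReal_mono hsub (measure_ne_top μ _)).trans ?_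
  rw [le_div_iff₀ hN]
  have h1 : N * (9 / 100 * (μ.real B * N)) ≤ N * (144 * K ^ 8) := by
    linarith [hmark.trans hmean]
  linarith [le_of_mul_le_mul_left h1 hN]

end MemClass

end Bridge

end Perc

namespace Perc

/-! ### Multiscale percolation of good sites in the plane -/

section Renormalisation

/-- The cell with local coordinates `(i, j)` in the `5 × 5` block indexed by `z`. -/
def cell (z : ℤ × ℤ) (i j : ℕ) : ℤ × ℤ := (5 * z.1 + i, 5 * z.2 + j)

/-- Local coordinates in a block that differ by at least two in one of the coordinates. -/
def FarApart (i j i' j' : ℕ) : Prop := i + 2 ≤ i' ∨ i' + 2 ≤ i ∨ j + 2 ≤ j' ∨ j' + 2 ≤ j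

/-- A block of level `n + 1` is good when no two far apart cells of it are bad. -/
def GoodBlock (g : ℤ × ℤ → Prop) : ℕ → ℤ × ℤ → Prop
  | 0, z => g z
  | n + 1, z => ∀ i < 5, ∀ j < 5, ∀ i' < 5, ∀ j' < 5, FarApart i j i' j' →
      GoodBlock g n (cell z i j) ∨ GoodBlock g n (cell z i' j')

/-- All cells of level `n` with first local coordinate `i` are good. -/
def FstClean (g : ℤ × ℤ → Prop) (n : ℕ) (z : ℤ × ℤ) (i : ℕ) : Prop :=
  ∀ j < 5, GoodBlock g n (cell z i j)

/-- All cells of level `n` with second local coordinate `j` are good. -/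
def SndClean (g : ℤ × ℤ → Prop) (n : ℕ) (z : ℤ × ℤ) (j : ℕ) : Prop :=
  ∀ i < 5, GoodBlock g n (cell z i j)

/-- The sites of a block that belong to clean lines at every level. -/
def core (g : ℤ × ℤ → Prop) : ℕ → ℤ × ℤ → Set (ℤ × ℤ)
  | 0, z => {z}
  | n + 1, z => {x | ∃ i < 5, ∃ j < 5, (FstClean g n z i ∨ SndClean g n z j) ∧
      x ∈ core g n (cell z i j)}

variable {g : ℤ × ℤ → Prop} {n : ℕ} {z z' : ℤ × ℤ}

/-- Bad cells on both lines would be far apart. -/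
theorem fstClean_or_of_goodBlock (h : GoodBlock g (n + 1) z) {i i' : ℕ} (hi : i < 5)
    (hi' : i' < 5) (hii : i + 2 ≤ i') : FstClean g n z i ∨ FstClean g n z i' := by
  by_contra! hc
  obtain ⟨h1, h2⟩ := hc
  simp only [FstClean, not_forall] at h1 h2
  obtain ⟨j, hj, hb⟩ := h1
  obtain ⟨j', hj', hb'⟩ := h2
  exact (h i hi j hj i' hi' j' hj' (Or.inl hii)).elim hb hb'

theorem sndClean_or_of_goodBlock (h : GoodBlock g (n + 1) z) {j j' : ℕ} (hj : j < 5)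
    (hj' : j' < 5) (hjj : j + 2 ≤ j') : SndClean g n z j ∨ SndClean g n z j' := by
  by_contra! hc
  obtain ⟨h1, h2⟩ := hc
  simp only [SndClean, not_forall] at h1 h2
  obtain ⟨i, hi, hb⟩ := h1
  obtain ⟨i', hi', hb'⟩ := h2
  exact (h i hi j hj i' hi' j' hj' (Or.inr (Or.inr (Or.inl hjj)))).elim hb hb'

theorem exists_fstClean (h : GoodBlock g (n + 1) z) : ∃ i < 5, FstClean g n z i := by
  rcases fstClean_or_of_goodBlock h (i := 0) (i' := 2) (by lia) (by lia) (by lia) with h | h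
  exacts [⟨0, by lia, h⟩, ⟨2, by lia, h⟩]

theorem exists_sndClean (h : GoodBlock g (n + 1) z) : ∃ j < 5, SndClean g n z j := by
  rcases sndClean_or_of_goodBlock h (j := 0) (j' := 2) (by lia) (by lia) (by lia) with h | h
  exacts [⟨0, by lia, h⟩, ⟨2, by lia, h⟩]

theorem exists_fstClean_both (h : GoodBlock g (n + 1) z) (h' : GoodBlock g (n + 1) z') :
    ∃ i < 5, FstClean g n z i ∧ FstClean g n z' i := by
  have a := fstClean_or_of_goodBlock h (i := 0) (i' := 2) (by lia) (by lia) (by lia)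
  have b := fstClean_or_of_goodBlock h (i := 0) (i' := 4) (by lia) (by lia) (by lia)
  have c := fstClean_or_of_goodBlock h (i := 2) (i' := 4) (by lia) (by lia) (by lia)
  have a' := fstClean_or_of_goodBlock h' (i := 0) (i' := 2) (by lia) (by lia) (by lia)
  have b' := fstClean_or_of_goodBlock h' (i := 0) (i' := 4) (by lia) (by lia) (by lia)
  have c' := fstClean_or_of_goodBlock h' (i := 2) (i' := 4) (by lia) (by lia) (by lia)
  have : (FstClean g n z 0 ∧ FstClean g n z' 0) ∨ (FstClean g n z 2 ∧ FstClean g n z' 2) ∨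
      (FstClean g n z 4 ∧ FstClean g n z' 4) := by tauto
  rcases this with h | h | h
  exacts [⟨0, by lia, h⟩, ⟨2, by lia, h⟩, ⟨4, by lia, h⟩]

theorem exists_sndClean_both (h : GoodBlock g (n + 1) z) (h' : GoodBlock g (n + 1) z') :
    ∃ j < 5, SndClean g n z j ∧ SndClean g n z' j := by
  have a := sndClean_or_of_goodBlock h (j := 0) (j' := 2) (by lia) (by lia) (by lia)
  have b := sndClean_or_of_goodBlock h (j := 0) (j' := 4) (by lia) (by lia) (by lia)
  have c := sndClean_or_of_goodBlock h (j := 2) (j' := 4) (by lia) (by lia) (by lia)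
  have a' := sndClean_or_of_goodBlock h' (j := 0) (j' := 2) (by lia) (by lia) (by lia)
  have b' := sndClean_or_of_goodBlock h' (j := 0) (j' := 4) (by lia) (by lia) (by lia)
  have c' := sndClean_or_of_goodBlock h' (j := 2) (j' := 4) (by lia) (by lia) (by lia)
  have : (SndClean g n z 0 ∧ SndClean g n z' 0) ∨ (SndClean g n z 2 ∧ SndClean g n z' 2) ∨
      (SndClean g n z 4 ∧ SndClean g n z' 4) := by tauto
  rcases this with h | h | h
  exacts [⟨0, by lia, h⟩, ⟨2, by lia, h⟩, ⟨4, by lia, h⟩]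

theorem core_nonempty (h : GoodBlock g n z) : (core g n z).Nonempty := by
  induction n generalizing z with
  | zero => exact ⟨z, rfl⟩
  | succ n ih =>
    obtain ⟨i, hi, hc⟩ := exists_fstClean h
    obtain ⟨x, hx⟩ := ih (hc 0 (by lia))
    exact ⟨x, i, hi, 0, by lia, Or.inl hc, hx⟩

theorem good_of_mem_core {x : ℤ × ℤ} (h : GoodBlock g n z) (hx : x ∈ core g n z) : g x := by
  induction n generalizing z with
  | zero => rw [core, Set.mem_singleton_iff] at hx; subst hx; exact h
  | succ n ih =>
    obtain ⟨i, hi, j, hj, hc, hx⟩ := hx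
    exact ih (hc.elim (fun h => h j hj) (fun h => h i hi)) hx

theorem le_of_mem_core {x : ℤ × ℤ} (hx : x ∈ core g n z) : 5 ^ n * z.1 ≤ x.1 := by
  induction n generalizing z with
  | zero => rw [core, Set.mem_singleton_iff] at hx; subst hx; simp
  | succ n ih =>
    obtain ⟨i, hi, j, hj, hc, hx⟩ := hx
    refine le_trans ?_ (ih hx)
    rw [pow_succ, mul_assoc]
    gcongr
    simp [cell]

/-- The cores of two blocks are joined when all their sites are related by `C`. -/
def CoresJoined (g : ℤ × ℤ → Prop) (C : ℤ × ℤ → ℤ × ℤ → Prop) (n : ℕ) (z z' : ℤ × ℤ) : Prop :=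
  ∀ x ∈ core g n z, ∀ y ∈ core g n z', C x y

variable {C : ℤ × ℤ → ℤ × ℤ → Prop}

theorem CoresJoined.trans (ht : ∀ x y w, C x y → C y w → C x w) {z₁ z₂ z₃ : ℤ × ℤ}
    (h : GoodBlock g n z₂) (h₁ : CoresJoined g C n z₁ z₂) (h₂ : CoresJoined g C n z₂ z₃) :
    CoresJoined g C n z₁ z₃ := fun x hx y hy => by
  obtain ⟨w, hw⟩ := core_nonempty h
  exact ht x w y (h₁ x hx w hw) (h₂ w hw y hy)

theorem CoresJoined.symm (hs : ∀ x y, C x y → C y x) (h : CoresJoined g C n z z') :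
    CoresJoined g C n z' z := fun x hx y hy => hs y x (h y hy x hx)

/-- The three claims are proved together by induction on the level: adjacency of cells joins the
cores along a clean line, crossing clean lines join a whole core, and a clean line common to two
adjacent blocks carries the connection across their border. -/
theorem coresJoined_of_goodBlock (hs : ∀ x y, C x y → C y x) (ht : ∀ x y w, C x y → C y w → C x w)
    (hr : ∀ x, g x → C x x) (h1 : ∀ x, g x → g (x + (1, 0)) → C x (x + (1, 0)))
    (h2 : ∀ x, g x → g (x + (0, 1)) → C x (x + (0, 1))) (n : ℕ) :
    (∀ z, GoodBlock g n z → CoresJoined g C n z z) ∧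
    (∀ z, GoodBlock g n z → GoodBlock g n (z + (1, 0)) → CoresJoined g C n z (z + (1, 0))) ∧
    (∀ z, GoodBlock g n z → GoodBlock g n (z + (0, 1)) → CoresJoined g C n z (z + (0, 1))) := by
  induction n with
  | zero =>
    refine ⟨fun z hz => ?_, fun z hz hz' => ?_, fun z hz hz' => ?_⟩ <;>
      rintro x rfl y rfl
    exacts [hr _ hz, h1 _ hz hz', h2 _ hz hz']
  | succ n ih =>
    obtain ⟨ih0, ih1, ih2⟩ := ih
    have fst0 : ∀ z i, FstClean g n z i → ∀ j < 5,
        CoresJoined g C n (cell z i 0) (cell z i j) := by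
      intro z i hc j
      induction j with
      | zero => exact fun _ => ih0 _ (hc 0 (by lia))
      | succ j ihj =>
        intro hj
        refine (ihj (by lia)).trans ht (hc j (by lia)) ?_
        have e : cell z i (j + 1) = cell z i j + (0, 1) := by
          ext <;> simp [cell]; ring
        rw [e]
        exact ih2 _ (hc j (by lia)) (e ▸ hc (j + 1) hj)
    have snd0 : ∀ z j, SndClean g n z j → ∀ i < 5,
        CoresJoined g C n (cell z 0 j) (cell z i j) := by
      intro z j hc i
      induction i with
      | zero => exact fun _ => ih0 _ (hc 0 (by lia))
      | succ i ihi =>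
        intro hi
        refine (ihi (by lia)).trans ht (hc i (by lia)) ?_
        have e : cell z (i + 1) j = cell z i j + (1, 0) := by
          ext <;> simp [cell]; ring
        rw [e]
        exact ih1 _ (hc i (by lia)) (e ▸ hc (i + 1) hi)
    have fst : ∀ z i, FstClean g n z i → ∀ j < 5, ∀ j' < 5,
        CoresJoined g C n (cell z i j) (cell z i j') := fun z i hc j hj j' hj' =>
      ((fst0 z i hc j hj).symm hs).trans ht (hc 0 (by lia)) (fst0 z i hc j' hj')
    have snd : ∀ z j, SndClean g n z j → ∀ i < 5, ∀ i' < 5,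
        CoresJoined g C n (cell z i j) (cell z i' j) := fun z j hc i hi i' hi' =>
      ((snd0 z j hc i hi).symm hs).trans ht (hc 0 (by lia)) (snd0 z j hc i' hi')
    have main : ∀ z, GoodBlock g (n + 1) z → CoresJoined g C (n + 1) z z := by
      intro z hz
      -- Two crossing clean lines; any other clean line meets one of them, so every core cell is
      -- joined to the crossing cell.
      obtain ⟨r, hr5, hr⟩ := exists_fstClean hz
      obtain ⟨c, hc5, hc⟩ := exists_sndClean hz
      have key : ∀ i < 5, ∀ j < 5, (FstClean g n z i ∨ SndClean g n z j) →
          CoresJoined g C n (cell z i j) (cell z r c) := by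
        rintro i hi j hj (h | h)
        · exact (fst z i h j hj c hc5).trans ht (h c hc5) (snd z c hc i hi r hr5)
        · exact (snd z j h i hi r hr5).trans ht (h r hr5) (fst z r hr j hj c hc5)
      rintro x ⟨i, hi, j, hj, hcl, hx⟩ y ⟨i', hi', j', hj', hcl', hy⟩
      exact ((key i hi j hj hcl).trans ht (hr c hc5) ((key i' hi' j' hj' hcl').symm hs)) x hx y hy
    refine ⟨main, fun z hz hz' => ?_, fun z hz hz' => ?_⟩
    · obtain ⟨j, hj, hc, hc'⟩ := exists_sndClean_both hz hz'
      have e : cell (z + (1, 0)) 0 j = cell z 4 j + (1, 0) := by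
        ext <;> simp [cell]; ring
      have hj1 := ih1 _ (hc 4 (by lia)) (e ▸ hc' 0 (by lia))
      obtain ⟨x', hx'⟩ := core_nonempty (hc 4 (by lia))
      obtain ⟨y', hy'⟩ := core_nonempty (hc' 0 (by lia))
      intro x hx y hy
      refine ht x x' y (main z hz x hx x' ⟨4, by lia, j, hj, Or.inr hc, hx'⟩) ?_
      refine ht x' y' y (hj1 x' hx' y' (e ▸ hy')) ?_
      exact main _ hz' y' ⟨0, by lia, j, hj, Or.inr hc', hy'⟩ y hy
    · obtain ⟨i, hi, hc, hc'⟩ := exists_fstClean_both hz hz'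
      have e : cell (z + (0, 1)) i 0 = cell z i 4 + (0, 1) := by
        ext <;> simp [cell]; ring
      have hj1 := ih2 _ (hc 4 (by lia)) (e ▸ hc' 0 (by lia))
      obtain ⟨x', hx'⟩ := core_nonempty (hc 4 (by lia))
      obtain ⟨y', hy'⟩ := core_nonempty (hc' 0 (by lia))
      intro x hx y hy
      refine ht x x' y (main z hz x hx x' ⟨i, hi, 4, by lia, Or.inl hc, hx'⟩) ?_
      refine ht x' y' y (hj1 x' hx' y' (e ▸ hy')) ?_
      exact main _ hz' y' ⟨i, hi, 0, by lia, Or.inl hc', hy'⟩ y hy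

/-- If all cells of the blocks at the origin are good at every level, then there is an infinite
set of good sites that are pairwise related. -/
theorem exists_infinite_of_goodBlock (hs : ∀ x y, C x y → C y x)
    (ht : ∀ x y w, C x y → C y w → C x w)
    (hr : ∀ x, g x → C x x) (h1 : ∀ x, g x → g (x + (1, 0)) → C x (x + (1, 0)))
    (h2 : ∀ x, g x → g (x + (0, 1)) → C x (x + (0, 1)))
    (hg : ∀ n, ∀ i < 5, ∀ j < 5, GoodBlock g n (cell 0 i j)) :
    ∃ S : Set (ℤ × ℤ), S.Infinite ∧ (∀ x ∈ S, g x) ∧ ∀ x ∈ S, ∀ y ∈ S, C x y := by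
  have c00 : cell 0 0 0 = 0 := by ext <;> simp [cell]
  have h0 : ∀ n, GoodBlock g n 0 := fun n => c00 ▸ hg n 0 (by lia) 0 (by lia)
  have sub : ∀ n, ∀ i < 5, ∀ j < 5, core g n (cell 0 i j) ⊆ core g (n + 1) 0 :=
    fun n i hi j hj x hx => ⟨i, hi, j, hj, Or.inl fun j hj => hg n i hi j hj, hx⟩
  have mono : Monotone fun n => core g n 0 :=
    monotone_nat_of_le_succ fun n => by
      have := sub n 0 (by lia) 0 (by lia)
      rwa [c00] at this
  refine ⟨⋃ n, core g n 0, fun hfin => ?_, ?_, ?_⟩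
  · obtain ⟨B, hB⟩ := (hfin.image Prod.fst).bddAbove
    obtain ⟨n, hn⟩ : ∃ n : ℕ, B < (n : ℤ) := ⟨B.toNat + 1, by lia⟩
    -- The cell next to the origin cell has all first coordinates at least `5 ^ n`, so the
    -- increasing union of cores is unbounded.
    obtain ⟨x, hx⟩ := core_nonempty (hg n 1 (by lia) 0 (by lia))
    have hle := le_of_mem_core hx
    have hxB : x.1 ≤ B := hB ⟨x, Set.mem_iUnion.2 ⟨n + 1, sub n 1 (by lia) 0 (by lia) hx⟩, rfl⟩
    have : (n : ℤ) < 5 ^ n := by exact_mod_cast Nat.lt_pow_self (by lia)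
    simp [cell] at hle
    lia
  · intro x hx
    obtain ⟨n, hn⟩ := Set.mem_iUnion.1 hx
    exact good_of_mem_core (h0 n) hn
  · intro x hx y hy
    obtain ⟨n, hn⟩ := Set.mem_iUnion.1 hx
    obtain ⟨k, hk⟩ := Set.mem_iUnion.1 hy
    exact (coresJoined_of_goodBlock hs ht hr h1 h2 (max n k)).1 0 (h0 _) x
      (mono (le_max_left n k) hn) y (mono (le_max_right n k) hk)

/-! ### Dependence between blocks and probability of bad blocks -/

/-- The sites whose states may influence the block of level `n` indexed by `z`. -/
def blockSites (n : ℕ) (z : ℤ × ℤ) : Set (ℤ × ℤ) :=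
  {x | 5 ^ n * z.1 ≤ x.1 ∧ x.1 ≤ 5 ^ n * (z.1 + 1) ∧ 5 ^ n * z.2 ≤ x.2 ∧
    x.2 ≤ 5 ^ n * (z.2 + 1)}

theorem blockSites_cell_subset (n : ℕ) (z : ℤ × ℤ) {i j : ℕ} (hi : i < 5) (hj : j < 5) :
    blockSites n (cell z i j) ⊆ blockSites (n + 1) z := by
  rintro x ⟨h1, h2, h3, h4⟩
  have p : (0 : ℤ) < 5 ^ n := by positivity
  have hi' : (i : ℤ) ≤ 4 := by lia
  have hj' : (j : ℤ) ≤ 4 := by lia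
  simp only [cell] at h1 h2 h3 h4
  refine ⟨?_, ?_, ?_, ?_⟩ <;> rw [pow_succ]
  · nlinarith [mul_nonneg p.le (Int.natCast_nonneg i)]
  · nlinarith [mul_le_mul_of_nonneg_left hi' p.le]
  · nlinarith [mul_nonneg p.le (Int.natCast_nonneg j)]
  · nlinarith [mul_le_mul_of_nonneg_left hj' p.le]

/-- The upper bounds in `blockSites` are not strict, since the goodness of a site involves its right
and upper neighbours. Adjacent cells therefore overlap, and a gap of two is needed. -/
theorem disjoint_blockSites_cell (n : ℕ) (z : ℤ × ℤ) {i j i' j' : ℕ} (h : FarApart i j i' j') :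
    Disjoint (blockSites n (cell z i j)) (blockSites n (cell z i' j')) := by
  rw [Set.disjoint_left]
  rintro x ⟨h1, h2, h3, h4⟩ ⟨h1', h2', h3', h4'⟩
  have p : (0 : ℤ) < 5 ^ n := by positivity
  simp only [cell] at h1 h2 h3 h4 h1' h2' h3' h4'
  rcases h with h | h | h | h
  · have h : (i : ℤ) + 2 ≤ i' := by exact_mod_cast h
    nlinarith [mul_le_mul_of_nonneg_left h p.le]
  · have h : (i' : ℤ) + 2 ≤ i := by exact_mod_cast h
    nlinarith [mul_le_mul_of_nonneg_left h p.le]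
  · have h : (j : ℤ) + 2 ≤ j' := by exact_mod_cast h
    nlinarith [mul_le_mul_of_nonneg_left h p.le]
  · have h : (j' : ℤ) + 2 ≤ j := by exact_mod_cast h
    nlinarith [mul_le_mul_of_nonneg_left h p.le]

variable {Ω : Type*} {mΩ : MeasurableSpace Ω}

theorem measurableSet_goodBlock {m : Set (ℤ × ℤ) → MeasurableSpace Ω} (hmono : Monotone m)
    {E : ℤ × ℤ → Set Ω} (hE : ∀ x, MeasurableSet[m (blockSites 0 x)] (E x)) (n : ℕ) (z : ℤ × ℤ) :
    MeasurableSet[m (blockSites n z)] {ω | GoodBlock (fun x => ω ∈ E x) n z} := by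
  induction n generalizing z with
  | zero => exact hE z
  | succ n ih =>
    simp only [GoodBlock, Set.ofPred_forall, Set.ofPred_or]
    refine MeasurableSet.iInter fun i => MeasurableSet.iInter fun hi => MeasurableSet.iInter fun j =>
      MeasurableSet.iInter fun hj => MeasurableSet.iInter fun i' => MeasurableSet.iInter fun hi' =>
      MeasurableSet.iInter fun j' => MeasurableSet.iInter fun hj' => MeasurableSet.iInter fun _ =>
      MeasurableSet.union ?_ ?_
    exacts [hmono (blockSites_cell_subset n z hi hj) _ (ih _),
      hmono (blockSites_cell_subset n z hi' hj') _ (ih _)]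

/-- A bad block contains two independent bad cells, with at most `25 ^ 2 = 625` choices, so the
bounds satisfy `q (n + 1) ≤ 625 * q n ^ 2`. Starting from `1 / (2 * 625)`, they at least halve at
each level. -/
theorem measure_not_goodBlock_le {μ : Measure Ω} [IsProbabilityMeasure μ]
    {m : Set (ℤ × ℤ) → MeasurableSpace Ω} (hmono : Monotone m)
    (hind : ∀ S T, Disjoint S T → Indep (m S) (m T) μ)
    {E : ℤ × ℤ → Set Ω} (hE : ∀ x, MeasurableSet[m (blockSites 0 x)] (E x))
    (hq : ∀ x, μ.real (E x)ᶜ ≤ 1 / 1250) (n : ℕ) (z : ℤ × ℤ) :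
    μ.real {ω | ¬ GoodBlock (fun x => ω ∈ E x) n z} ≤ 1 / 1250 * (1 / 2) ^ n := by
  induction n generalizing z with
  | zero => rw [pow_zero, mul_one]; exact hq z
  | succ n ih =>
    classical
    set P : Finset ((ℕ × ℕ) × ℕ × ℕ) := ((Finset.range 5 ×ˢ Finset.range 5) ×ˢ
      (Finset.range 5 ×ˢ Finset.range 5)).filter fun p => FarApart p.1.1 p.1.2 p.2.1 p.2.2 with hP
    have hcard : (P.card : ℝ) ≤ 625 := by
      have : P.card ≤ 625 := (Finset.card_filter_le _ _).trans (by simp)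
      exact_mod_cast this
    set B : ℕ × ℕ → Set Ω := fun p => {ω | ¬ GoodBlock (fun x => ω ∈ E x) n (cell z p.1 p.2)}
    have hsub : {ω | ¬ GoodBlock (fun x => ω ∈ E x) (n + 1) z} ⊆ ⋃ p ∈ P, B p.1 ∩ B p.2 := by
      intro ω hω
      simp only [GoodBlock, Set.mem_ofPred_eq, not_forall, not_or] at hω
      obtain ⟨i, hi, j, hj, i', hi', j', hj', hf, hb⟩ := hω
      refine Set.mem_biUnion (x := ((i, j), i', j')) ?_ hb
      simp [hP, hi, hj, hi', hj', hf]
    have hterm : ∀ p ∈ P, μ.real (B p.1 ∩ B p.2) ≤ (1 / 1250 * (1 / 2) ^ n) ^ 2 := by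
      intro p hp
      have hf := (Finset.mem_filter.1 hp).2
      have hi := (Indep_iff _ _ μ).1 (hind _ _ (disjoint_blockSites_cell n z hf)) _ _
        (measurableSet_goodBlock hmono hE n (cell z p.1.1 p.1.2)).compl
        (measurableSet_goodBlock hmono hE n (cell z p.2.1 p.2.2)).compl
      have : μ.real (B p.1 ∩ B p.2) = μ.real (B p.1) * μ.real (B p.2) := by
        rw [measureReal_def, measureReal_def, measureReal_def, ← ENNReal.toReal_mul]
        exact congrArg _ hi
      rw [this, sq]
      exact mul_le_mul (ih _) (ih _) measureReal_nonneg (by positivity)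
    calc μ.real {ω | ¬ GoodBlock (fun x => ω ∈ E x) (n + 1) z}
        ≤ μ.real (⋃ p ∈ P, B p.1 ∩ B p.2) := measureReal_mono hsub (measure_ne_top μ _)
      _ ≤ ∑ p ∈ P, μ.real (B p.1 ∩ B p.2) := measureReal_biUnion_finset_le _ _
      _ ≤ P.card • (1 / 1250 * (1 / 2) ^ n) ^ 2 := Finset.sum_le_card_nsmul _ _ _ hterm
      _ ≤ 625 * (1 / 1250 * (1 / 2) ^ n) ^ 2 := by rw [nsmul_eq_mul]; gcongr
      _ = (1 / 1250 * (1 / 2) ^ (n + 1)) * (1 / 2) ^ n := by ring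
      _ ≤ 1 / 1250 * (1 / 2) ^ (n + 1) := by
        refine mul_le_of_le_one_right (by positivity) (pow_le_one₀ (by norm_num) (by norm_num))

/-- Percolation of good sites: with positive probability, all the cells of the blocks at the
origin are good at every level. -/
theorem measure_forall_goodBlock_pos {μ : Measure Ω} [IsProbabilityMeasure μ]
    {m : Set (ℤ × ℤ) → MeasurableSpace Ω} (hmono : Monotone m)
    (hind : ∀ S T, Disjoint S T → Indep (m S) (m T) μ)
    {E : ℤ × ℤ → Set Ω} (hE : ∀ x, MeasurableSet[m (blockSites 0 x)] (E x))
    (hq : ∀ x, μ.real (E x)ᶜ ≤ 1 / 1250) :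
    0 < μ {ω | ∀ n, ∀ i < 5, ∀ j < 5, GoodBlock (fun x => ω ∈ E x) n (cell 0 i j)} := by
  set A := {ω | ∀ n, ∀ i < 5, ∀ j < 5, GoodBlock (fun x => ω ∈ E x) n (cell 0 i j)}
  set B : ℕ → ℕ × ℕ → Set Ω := fun n p => {ω | ¬ GoodBlock (fun x => ω ∈ E x) n (cell 0 p.1 p.2)}
  set P := Finset.range 5 ×ˢ Finset.range 5 with hP
  -- A union over 25 cells, `25 / 1250 = 1 / 50`; summing over the levels gives `1 / 25 < 1`.
  have hlev : ∀ n, μ (⋃ p ∈ P, B n p) ≤ ENNReal.ofReal (1 / 50 * (1 / 2) ^ n) := by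
    intro n
    rw [← ofReal_measureReal (measure_ne_top μ _)]
    refine ENNReal.ofReal_le_ofReal ((measureReal_biUnion_finset_le _ _).trans
      ((Finset.sum_le_card_nsmul _ _ _ fun p _ =>
        measure_not_goodBlock_le hmono hind hE hq n (cell 0 p.1 p.2)).trans (le_of_eq ?_)))
    simp [hP]
    ring
  have hcompl : Aᶜ ⊆ ⋃ n, ⋃ p ∈ P, B n p := by
    intro ω hω
    simp only [A, Set.mem_compl_iff, Set.mem_ofPred_eq, not_forall] at hω
    obtain ⟨n, i, hi, j, hj, hb⟩ := hω
    exact Set.mem_iUnion.2 ⟨n, Set.mem_biUnion (x := (i, j)) (by simp [hP, hi, hj]) hb⟩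
  have hbound : μ Aᶜ ≤ ENNReal.ofReal (1 / 25) := by
    refine (measure_mono hcompl).trans ((measure_iUnion_le _).trans
      ((ENNReal.tsum_le_tsum hlev).trans (le_of_eq ?_)))
    have hsum : HasSum (fun n : ℕ => (1 / 50 : ℝ) * (1 / 2) ^ n) (1 / 50 * 2) :=
      hasSum_geometric_two.mul_left _
    rw [← ENNReal.ofReal_tsum_of_nonneg (fun n => by positivity) hsum.summable, hsum.tsum_eq]
    norm_num
  rw [pos_iff_ne_zero]
  intro h0
  have : (1 : ENNReal) ≤ ENNReal.ofReal (1 / 25) :=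
    calc (1 : ENNReal) = μ (A ∪ Aᶜ) := by simp
      _ ≤ μ A + μ Aᶜ := measure_union_le _ _
      _ ≤ _ := by rw [h0, zero_add]; exact hbound
  rw [← ENNReal.ofReal_one, ENNReal.ofReal_le_ofReal_iff (by norm_num)] at this
  norm_num at this

end Renormalisation

end Perc

namespace Perc

/-! ### From open paths to linked vertices -/

section Percolation

/-- `u` and `v` are vertices of `H` in the same component. -/
def Linked {V : Type*} {G : SimpleGraph V} (H : G.Subgraph) (u v : V) : Prop :=
  ∃ (hu : u ∈ H.verts) (hv : v ∈ H.verts), H.coe.Reachable ⟨u, hu⟩ ⟨v, hv⟩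

namespace Linked

variable {V : Type*} {G : SimpleGraph V} {H : G.Subgraph} {u v w : V}

theorem refl (hu : u ∈ H.verts) : Linked H u u := ⟨hu, hu, SimpleGraph.Reachable.refl _⟩

theorem symm : Linked H u v → Linked H v u := fun ⟨hu, hv, h⟩ => ⟨hv, hu, h.symm⟩

theorem trans : Linked H u v → Linked H v w → Linked H u w :=
  fun ⟨hu, _, h⟩ ⟨_, hw, h'⟩ => ⟨hu, hw, h.trans h'⟩

theorem of_adj (h : H.Adj u v) : Linked H u v :=
  ⟨h.fst_mem, h.snd_mem, SimpleGraph.Adj.reachable (SimpleGraph.Subgraph.coe_adj H _ _ ▸ h)⟩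

theorem hasInfiniteComponent {W : Set V} (hW : W.Infinite)
    (h : ∀ u ∈ W, ∀ v ∈ W, Linked H u v) : HasInfiniteComponent H := by
  obtain ⟨u, hu⟩ := hW.nonempty
  obtain ⟨huH, -, -⟩ := h u hu u hu
  refine ⟨H.coe.connectedComponentMk ⟨u, huH⟩, fun hfin => hW ?_⟩
  refine (hfin.image Subtype.val).subset fun v hv => ?_
  obtain ⟨hvH, _, hr⟩ := h v hv u hu
  exact ⟨⟨v, hvH⟩, SimpleGraph.ConnectedComponent.eq.2 hr, rfl⟩

end Linked

theorem linked_of_notMem_bridgesFail {V κ : Type*} {G : SimpleGraph V} {H : G.Subgraph} {u w : V}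
    {p : Fin 4 → κ → V} (h : H ∉ bridgesFail G u w p) : Linked H u w := by
  simp only [bridgesFail, Set.mem_ofPred_eq, not_forall, not_not] at h
  obtain ⟨j, h0, h1, h2, h3, h4⟩ := h
  exact (Linked.of_adj h0).trans ((Linked.of_adj h1).trans ((Linked.of_adj h2).trans
    ((Linked.of_adj h3).trans (Linked.of_adj h4))))

theorem measurableSet_bridgesFail {V κ : Type*} [Finite κ] {G : SimpleGraph V} {S : Set V}
    {u w : V} {p : Fin 4 → κ → V} (hu : u ∈ S) (hw : w ∈ S) (hp : ∀ s j, p s j ∈ S)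
    (hadju : ∀ j, G.Adj u (p 0 j)) (h01 : ∀ j, G.Adj (p 0 j) (p 1 j))
    (h12 : ∀ j, G.Adj (p 1 j) (p 2 j)) (h23 : ∀ j, G.Adj (p 2 j) (p 3 j))
    (hadjw : ∀ j, G.Adj w (p 3 j)) : MeasurableSet[regionSigma G S] (bridgesFail G u w p) := by
  have : bridgesFail G u w p = ⋂ j, (edgeOpen G s(u, p 0 j) ∩ (edgeOpen G s(p 0 j, p 1 j) ∩
      (edgeOpen G s(p 1 j, p 2 j) ∩ (edgeOpen G s(p 2 j, p 3 j) ∩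
        edgeOpen G s(p 3 j, w)))))ᶜ := by
    ext H
    simp [bridgesFail, edgeOpen]
  rw [this]
  exact MeasurableSet.iInter fun j => ((measurableSet_edgeOpen hu (hp 0 j) (hadju j)).inter
    ((measurableSet_edgeOpen (hp 0 j) (hp 1 j) (h01 j)).inter
      ((measurableSet_edgeOpen (hp 1 j) (hp 2 j) (h12 j)).inter
        ((measurableSet_edgeOpen (hp 2 j) (hp 3 j) (h23 j)).inter
          (measurableSet_edgeOpen (hp 3 j) hw (hadjw j).symm))))).compl

theorem MemClass.measureReal_biInter_le {V ι : Type*} {G : SimpleGraph V} {pv pe : ℝ}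
    {μ : Measure G.Subgraph} (h : MemClass G pv pe μ) {S : ι → Set V}
    (hS : ∀ i k, i ≠ k → Disjoint (S i) (S k)) {A : ι → Set G.Subgraph}
    (hA : ∀ i, MeasurableSet[regionSigma G (S i)] (A i)) {q : ℝ} (hq : ∀ i, μ.real (A i) ≤ q)
    (s : Finset ι) : μ.real (⋂ i ∈ s, A i) ≤ q ^ s.card := by
  classical
  have := h.isProbabilityMeasure
  induction s using Finset.induction_on with
  | empty => simp
  | insert i s hi ih =>
    have hm : MeasurableSet[regionSigma G (⋃ k ∈ s, S k)] (⋂ k ∈ s, A k) :=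
      MeasurableSet.biInter s.countable_toSet fun k hk =>
        regionSigma_mono (Set.subset_biUnion_of_mem (u := S) hk) _ (hA k)
    have hd : Disjoint (S i) (⋃ k ∈ s, S k) :=
      Set.disjoint_iUnion₂_right.2 fun k hk => hS i k fun e => hi (e ▸ hk)
    have := (Indep_iff _ _ μ).1 (h.indep_region hd) _ _ (hA i) hm
    rw [Finset.set_biInter_insert, measureReal_def, this, ENNReal.toReal_mul,
      Finset.card_insert_of_notMem hi, pow_succ']
    exact mul_le_mul (hq i) ih measureReal_nonneg (measureReal_nonneg.trans (hq i))

variable {α ι κ : Type*} {Q : SimpleGraph α}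

theorem squareLattice_adj_add_fst (x : ℤ × ℤ) : squareLattice.Adj x (x + (1, 0)) := by
  simp [squareLattice]

theorem squareLattice_adj_add_snd (x : ℤ × ℤ) : squareLattice.Adj x (x + (0, 1)) := by
  simp [squareLattice]

/-! ### Hub systems and percolation in a product graph -/

/-- A system of hubs, each with its own spokes, whose ends are adjacent to common vertices. -/
structure HubSystem (Q : SimpleGraph α) (ι κ : Type*) where
  /-- the hubs -/
  hub : ι → α
  /-- the neighbours of the hubs -/
  spoke : ι → κ → α
  /-- the common vertices -/
  mid : κ → α
  hub_ne_spoke : ∀ i k j, hub i ≠ spoke k j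
  hub_ne_mid : ∀ i j, hub i ≠ mid j
  hub_injective : Function.Injective hub
  spoke_ne_mid : ∀ i j l, spoke i j ≠ mid l
  spoke_inj : ∀ i j k l, spoke i j = spoke k l → i = k ∧ j = l
  mid_injective : Function.Injective mid
  adj_hub : ∀ i j, Q.Adj (hub i) (spoke i j)
  adj_spoke : ∀ i j, Q.Adj (spoke i j) (mid j)

namespace HubSystem

variable (D : HubSystem Q ι κ)

/-- The paths between the hubs over two adjacent sites. -/
def bridge (x y : ℤ × ℤ) (i k : ι) : Fin 4 → κ → (ℤ × ℤ) × α :=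
  ![fun j => (x, D.spoke i j), fun j => (x, D.mid j), fun j => (y, D.mid j),
    fun j => (y, D.spoke k j)]

theorem bridge_inj {x y : ℤ × ℤ} (hxy : x ≠ y) (i k : ι) (s : Fin 4) (j : κ) (s' : Fin 4)
    (j' : κ) (h : D.bridge x y i k s j = D.bridge x y i k s' j') : s = s' ∧ j = j' := by
  have hne : ∀ i j l, D.mid l ≠ D.spoke i j := fun i j l => (D.spoke_ne_mid i j l).symm
  fin_cases s <;> fin_cases s' <;>
    simp [bridge, hxy, hxy.symm, D.spoke_ne_mid, hne] at h ⊢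
  exacts [(D.spoke_inj _ _ _ _ h).2, D.mid_injective h, D.mid_injective h,
    (D.spoke_inj _ _ _ _ h).2]

theorem hub_ne_bridge (x y z : ℤ × ℤ) (l i k : ι) (s : Fin 4) (j : κ) :
    (z, D.hub l) ≠ D.bridge x y i k s j := by
  fin_cases s <;> simp [bridge, D.hub_ne_spoke, D.hub_ne_mid]

theorem bridge_fst (x y : ℤ × ℤ) (i k : ι) (s : Fin 4) (j : κ) :
    (D.bridge x y i k s j).1 = x ∨ (D.bridge x y i k s j).1 = y := by
  fin_cases s <;> simp [bridge]

theorem adj_hub_spoke (x : ℤ × ℤ) (i : ι) (j : κ) :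
    (squareLattice.boxProd Q).Adj (x, D.hub i) (x, D.spoke i j) :=
  Or.inr ⟨D.adj_hub i j, rfl⟩

theorem adj_spoke_mid (x : ℤ × ℤ) (i : ι) (j : κ) :
    (squareLattice.boxProd Q).Adj (x, D.spoke i j) (x, D.mid j) :=
  Or.inr ⟨D.adj_spoke i j, rfl⟩

theorem adj_mid_mid {x y : ℤ × ℤ} (hxy : squareLattice.Adj x y) (j : κ) :
    (squareLattice.boxProd Q).Adj (x, D.mid j) (y, D.mid j) :=
  Or.inl ⟨hxy, rfl⟩

variable [Fintype κ]

/-- The event that the hub `i` over the site `x` is good. -/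
def good (μ : Measure (squareLattice.boxProd Q).Subgraph) (x : ℤ × ℤ) (i : ι) :
    Set (squareLattice.boxProd Q).Subgraph :=
  goodHub μ (x, D.hub i) fun j => (x, D.spoke i j)

/-- The event that some two good hubs over `x` and `y` are not joined directly. -/
def bad (μ : Measure (squareLattice.boxProd Q).Subgraph) (x y : ℤ × ℤ) :
    Set (squareLattice.boxProd Q).Subgraph :=
  ⋃ q : ι × ι, D.good μ x q.1 ∩ D.good μ y q.2 ∩
    bridgesFail (squareLattice.boxProd Q) (x, D.hub q.1) (y, D.hub q.2) (D.bridge x y q.1 q.2)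

/-- The event that some hub over `x` is good and well joined to the sites above and to the
right. -/
def siteGood (μ : Measure (squareLattice.boxProd Q).Subgraph) (x : ℤ × ℤ) :
    Set (squareLattice.boxProd Q).Subgraph :=
  (⋃ i, D.good μ x i) ∩ ((D.bad μ x (x + (1, 0)))ᶜ ∩ (D.bad μ x (x + (0, 1)))ᶜ)

variable {pv pe : ℝ} {μ : Measure (squareLattice.boxProd Q).Subgraph}

theorem measurableSet_good {T : Set (ℤ × ℤ)} {x : ℤ × ℤ} (hx : x ∈ T) (i : ι) :
    MeasurableSet[regionSigma (squareLattice.boxProd Q) (T ×ˢ Set.univ)] (D.good μ x i) :=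
  measurableSet_goodHub (by simp [hx]) (by simp [hx]) (D.adj_hub_spoke x i) μ

theorem measurableSet_bad [Finite ι] {T : Set (ℤ × ℤ)} {x y : ℤ × ℤ} (hx : x ∈ T) (hy : y ∈ T)
    (hxy : squareLattice.Adj x y) :
    MeasurableSet[regionSigma (squareLattice.boxProd Q) (T ×ˢ Set.univ)] (D.bad μ x y) := by
  refine MeasurableSet.iUnion fun q => ((D.measurableSet_good hx q.1).inter
    (D.measurableSet_good hy q.2)).inter (measurableSet_bridgesFail (by simp [hx]) (by simp [hy])
    (fun s j => ?_) (D.adj_hub_spoke x q.1) (D.adj_spoke_mid x q.1) (D.adj_mid_mid hxy)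
    (fun j => (D.adj_spoke_mid y q.2 j).symm) (D.adj_hub_spoke y q.2))
  rcases D.bridge_fst x y q.1 q.2 s j with h | h <;> simp [h, hx, hy]

theorem measurableSet_siteGood [Finite ι] (x : ℤ × ℤ) :
    MeasurableSet[regionSigma (squareLattice.boxProd Q) (blockSites 0 x ×ˢ Set.univ)]
      (D.siteGood μ x) := by
  have h0 : x ∈ blockSites 0 x := by simp [blockSites]
  have h1 : x + (1, 0) ∈ blockSites 0 x := by simp [blockSites]
  have h2 : x + (0, 1) ∈ blockSites 0 x := by simp [blockSites]
  exact (MeasurableSet.iUnion fun i => D.measurableSet_good h0 i).inter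
    ((D.measurableSet_bad h0 h1 (squareLattice_adj_add_fst x)).compl.inter
      (D.measurableSet_bad h0 h2 (squareLattice_adj_add_snd x)).compl)

variable [Fintype ι] [Nonempty κ]

theorem measureReal_bad_le (h : MemClass (squareLattice.boxProd Q) pv pe μ) (hpv : 0 < pv)
    (hpv1 : pv ≤ 1) (hpe : 9 / 10 ≤ pe) {x y : ℤ × ℤ}
    (hxy : squareLattice.Adj x y) : μ.real (D.bad μ x y) ≤
      Fintype.card ι ^ 2 * (1600 * pv⁻¹ ^ 8 / Fintype.card κ) := by
  have key : ∀ q : ι × ι, μ.real (D.good μ x q.1 ∩ D.good μ y q.2 ∩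
      bridgesFail (squareLattice.boxProd Q) (x, D.hub q.1) (y, D.hub q.2)
        (D.bridge x y q.1 q.2)) ≤ 1600 * pv⁻¹ ^ 8 / Fintype.card κ := fun q =>
    h.measureReal_bridgesFail_le (p := D.bridge x y q.1 q.2) hpv hpv1 hpe
      (D.bridge_inj hxy.ne q.1 q.2) (D.hub_ne_bridge x y x q.1 q.1 q.2)
      (D.hub_ne_bridge x y y q.2 q.1 q.2) (D.adj_hub_spoke x q.1) (D.adj_spoke_mid x q.1)
      (D.adj_mid_mid hxy) (fun j => (D.adj_spoke_mid y q.2 j).symm) (D.adj_hub_spoke y q.2)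
  have := h.isProbabilityMeasure
  refine (measureReal_iUnion_fintype_le _).trans
    ((Finset.sum_le_card_nsmul _ _ _ fun q _ => key q).trans (le_of_eq ?_))
  simp [sq]

/-- The goodness of a hub is determined by its star, and the stars of distinct hubs are
vertex-disjoint, so the failures multiply. The mids, which are shared, play no part in it. -/
theorem measureReal_iInter_compl_good_le (h : MemClass (squareLattice.boxProd Q) pv pe μ)
    (hpv : 0 < pv) (hpe : 9 / 10 ≤ pe) (x : ℤ × ℤ) :
    μ.real (⋃ i, D.good μ x i)ᶜ ≤ (1 - pv / 2) ^ Fintype.card ι := by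
  have key := h.measureReal_biInter_le
    (S := fun i => insert (x, D.hub i) (Set.range fun j => (x, D.spoke i j)))
    (A := fun i => (D.good μ x i)ᶜ) (fun i k hik => ?_)
    (fun i => (measurableSet_goodHub (by simp) (by simp) (D.adj_hub_spoke x i) μ).compl)
    (fun i => h.measureReal_compl_goodHub_le hpv hpe (D.adj_hub_spoke x i)) Finset.univ
  · simpa [Set.compl_iUnion] using key
  · rw [Set.disjoint_left]
    rintro _ (rfl | ⟨j, rfl⟩) (h' | ⟨l, h'⟩)
    · exact hik (D.hub_injective (Prod.ext_iff.1 h').2)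
    · exact D.hub_ne_spoke i k l (Prod.ext_iff.1 h').2.symm
    · exact D.hub_ne_spoke k i j (Prod.ext_iff.1 h').2.symm
    · exact hik (D.spoke_inj _ _ _ _ (Prod.ext_iff.1 h').2).1.symm

theorem measureReal_compl_siteGood_le (h : MemClass (squareLattice.boxProd Q) pv pe μ)
    (hpv : 0 < pv) (hpv1 : pv ≤ 1) (hpe : 9 / 10 ≤ pe) (x : ℤ × ℤ) :
    μ.real (D.siteGood μ x)ᶜ ≤ (1 - pv / 2) ^ Fintype.card ι +
      2 * (Fintype.card ι ^ 2 * (1600 * pv⁻¹ ^ 8 / Fintype.card κ)) := by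
  have e : (D.siteGood μ x)ᶜ = (⋃ i, D.good μ x i)ᶜ ∪
      (D.bad μ x (x + (1, 0)) ∪ D.bad μ x (x + (0, 1))) := by
    rw [siteGood, Set.compl_inter, Set.compl_inter, compl_compl, compl_compl]
  have h0 := D.measureReal_iInter_compl_good_le h hpv hpe x
  have h1 := D.measureReal_bad_le h hpv hpv1 hpe (squareLattice_adj_add_fst x)
  have h2 := D.measureReal_bad_le h hpv hpv1 hpe (squareLattice_adj_add_snd x)
  rw [e]
  have u1 := measureReal_union_le (μ := μ) (⋃ i, D.good μ x i)ᶜ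
    (D.bad μ x (x + (1, 0)) ∪ D.bad μ x (x + (0, 1)))
  have u2 := measureReal_union_le (μ := μ) (D.bad μ x (x + (1, 0))) (D.bad μ x (x + (0, 1)))
  linarith

/-- Regions of the plane are lifted to full columns over them, so vertex-disjointness supplies the
independence required by the multiscale argument. Connectivity of good sites then transfers to hubs.
-/
theorem percolates (D : HubSystem Q ι κ) [Nonempty ι]
    (h : MemClass (squareLattice.boxProd Q) pv pe μ) (hpv : 0 < pv)
    (hpv1 : pv ≤ 1) (hpe : 9 / 10 ≤ pe)
    (hq : (1 - pv / 2) ^ Fintype.card ι +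
      2 * (Fintype.card ι ^ 2 * (1600 * pv⁻¹ ^ 8 / Fintype.card κ)) ≤ 1 / 1250) :
    Percolates μ := by
  have := h.isProbabilityMeasure
  refine (measure_forall_goodBlock_pos (μ := μ)
    (m := fun T => regionSigma (squareLattice.boxProd Q) (T ×ˢ Set.univ))
    (fun S T hST => regionSigma_mono (Set.prod_mono_left hST))
    (fun S T hST => h.indep_region (Set.disjoint_prod.2 (Or.inl hST)))
    (E := D.siteGood μ) (fun x => D.measurableSet_siteGood x)
    (fun x => (D.measureReal_compl_siteGood_le h hpv hpv1 hpe x).trans hq)).trans_le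
    (measure_mono fun H hH => ?_)
  have hex : ∀ x, ∃ i, H ∈ D.siteGood μ x → H ∈ D.good μ x i := by
    intro x
    by_cases hx : H ∈ D.siteGood μ x
    · obtain ⟨i, hi⟩ := Set.mem_iUnion.1 hx.1
      exact ⟨i, fun _ => hi⟩
    · exact ⟨Classical.arbitrary ι, fun h => absurd h hx⟩
  -- One good hub per good site, chosen arbitrarily: the event `bad` ranges over all pairs of hubs,
  -- so any choices over adjacent good sites are linked.
  choose c hc using hex
  have step : ∀ x y, H ∈ D.siteGood μ x → H ∈ D.siteGood μ y → H ∉ D.bad μ x y →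
      Linked H (x, D.hub (c x)) (y, D.hub (c y)) := fun x y hx hy hb =>
    linked_of_notMem_bridgesFail fun hf =>
      hb (Set.mem_iUnion.2 ⟨(c x, c y), ⟨hc x hx, hc y hy⟩, hf⟩)
  obtain ⟨S, hS, -, hC⟩ := exists_infinite_of_goodBlock (g := fun x => H ∈ D.siteGood μ x)
    (C := fun x y => Linked H (x, D.hub (c x)) (y, D.hub (c y)))
    (fun _ _ h => h.symm) (fun _ _ _ h h' => h.trans h')
    (fun x hx => Linked.refl (hc x hx).1)
    (fun x hx hy => step _ _ hx hy hx.2.1) (fun x hx hy => step _ _ hx hy hx.2.2) hH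
  refine Linked.hasInfiniteComponent (W := (fun x => (x, D.hub (c x))) '' S)
    (hS.image fun x _ y _ hxy => (Prod.ext_iff.1 hxy).1) ?_
  rintro _ ⟨x, hx, rfl⟩ _ ⟨y, hy, rfl⟩
  exact hC x hx y hy

end HubSystem

/-! ### A hub system in the hypercube -/

/-- The vertex of the hypercube whose coordinates equal to one are those in `S`. -/
def cubeVertex (m : ℕ) (S : Finset ℕ) : Fin m → Bool := fun c => decide (c.val ∈ S)

theorem mem_iff_of_cubeVertex_eq {m : ℕ} {S T : Finset ℕ} (h : cubeVertex m S = cubeVertex m T)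
    {a : ℕ} (ha : a < m) : a ∈ S ↔ a ∈ T :=
  decide_eq_decide.1 (congrFun h ⟨a, ha⟩)

theorem hypercube_adj_insert {m a : ℕ} {S : Finset ℕ} (ham : a < m) (haS : a ∉ S) :
    (hypercube m).Adj (cubeVertex m S) (cubeVertex m (insert a S)) := by
  change hammingDist _ _ = 1
  rw [hammingDist, Finset.card_eq_one]
  refine ⟨⟨a, ham⟩, ?_⟩
  ext c
  simp only [cubeVertex, Finset.mem_filter, Finset.mem_univ, true_and, Finset.mem_singleton,
    Finset.mem_insert, Fin.ext_iff, ne_eq, decide_eq_decide]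
  grind

/-- Hubs and spokes in the hypercube at distance one and two from the origin. -/
def cubeHubSystem {m M N : ℕ} (h : M + N ≤ m) : HubSystem (hypercube m) (Fin M) (Fin N) where
  hub i := cubeVertex m {i.val}
  spoke i j := cubeVertex m {M + j.val, i.val}
  mid j := cubeVertex m {M + j.val}
  hub_ne_spoke i k j e := by
    have h1 := mem_iff_of_cubeVertex_eq e (a := M + j) (by lia)
    simp only [Finset.mem_insert, Finset.mem_singleton] at h1
    lia
  hub_ne_mid i j e := by
    have h1 := mem_iff_of_cubeVertex_eq e (a := M + j) (by lia)
    simp only [Finset.mem_singleton] at h1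
    lia
  hub_injective i k e := by
    have h1 := mem_iff_of_cubeVertex_eq e (a := i) (by lia)
    simp only [Finset.mem_singleton] at h1
    lia
  spoke_ne_mid i j l e := by
    have h1 := mem_iff_of_cubeVertex_eq e (a := i) (by lia)
    simp only [Finset.mem_insert, Finset.mem_singleton] at h1
    lia
  spoke_inj i j k l e := by
    have h1 := mem_iff_of_cubeVertex_eq e (a := M + j) (by lia)
    have h2 := mem_iff_of_cubeVertex_eq e (a := i) (by lia)
    simp only [Finset.mem_insert, Finset.mem_singleton] at h1 h2
    lia
  mid_injective j l e := by
    have h1 := mem_iff_of_cubeVertex_eq e (a := M + j) (by lia)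
    simp only [Finset.mem_singleton] at h1
    lia
  adj_hub i j := hypercube_adj_insert (by lia) (by simp; lia)
  adj_spoke i j := by
    rw [Finset.pair_comm]
    exact (hypercube_adj_insert (by lia) (by simp; lia)).symm

end Percolation

end Perc

/-! ### Choice of the dimension -/

theorem mainTheorem9 (pv pe : ℝ) (hpv : pv ∈ Set.Ioc (0 : ℝ) 1)
    (hpe : pe ∈ Set.Ioc (18 / 19 : ℝ) 1) :
    ∃ N : ℕ, 2 ≤ N ∧ ∀ n : ℕ, N ≤ n →
      ∀ μ : MeasureTheory.Measure (Perc.latticeCube (n - 2)).Subgraph,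
        Perc.MemClass (Perc.latticeCube (n - 2)) pv pe μ → Perc.Percolates μ := by
  obtain ⟨hpv0, hpv1⟩ := hpv
  have hpe0 := hpe.1
  have hpow : Filter.Tendsto (fun k : ℕ => (1 - pv / 2) ^ k) Filter.atTop (nhds 0) :=
    tendsto_pow_atTop_nhds_zero_of_lt_one (by linarith) (by linarith)
  -- The allowance `1 / 1250` is split in two halves: `M` hubs make the lack of a good hub unlikely,
  -- and then, with `M` fixed, `K` spokes per hub beat the union bound over `M ^ 2` pairs.
  obtain ⟨M, hM, hM1⟩ := ((hpow.eventually_le_const (u := 1 / 2500) (by norm_num)).and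
    (Filter.eventually_ge_atTop 1)).exists
  have hdiv := tendsto_const_div_atTop_nhds_zero_nat (2 * ((M : ℝ) ^ 2 * (1600 * pv⁻¹ ^ 8)))
  obtain ⟨K, hK, hK1⟩ := ((hdiv.eventually_le_const (u := 1 / 2500) (by norm_num)).and
    (Filter.eventually_ge_atTop 1)).exists
  refine ⟨M + K + 2, by lia, fun n hn μ h => ?_⟩
  have : Nonempty (Fin M) := ⟨⟨0, hM1⟩⟩
  have : Nonempty (Fin K) := ⟨⟨0, hK1⟩⟩
  have hMK : M + K ≤ n - 2 := by lia
  refine (Perc.cubeHubSystem hMK).percolates h hpv0 hpv1 (by linarith) ?_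
  rw [Fintype.card_fin, Fintype.card_fin, ← mul_div_assoc, ← mul_div_assoc]
  linarith
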